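/- Let $d\ge 3$ be an odd integer, let $\mathbb B^{d+2}$ be the open unit ball of $\mathbb R^{d+2}$, and for $m\in\mathbb N$ let $H^m_{\mathrm{rad}}(\mathbb B^{d+2})$ be the space of complex-valued functions $u$ on $(0,1)$ (modulo null sets) for which the radial function $\hat u(\xi)=u(|\xi|)$ belongs to the Sobolev space $H^m(\mathbb B^{d+2})=W^{m,2}(\mathbb B^{d+2})$, with norm $\|u\|_{H^m_{\mathrm{rad}}}=\|\hat u\|_{H^m(\mathbb B^{d+2})}$. Let $$\mathcal H=H^{\frac{d+3}{2}}_{\mathrm{rad}}(\mathbb B^{d+2})\times H^{\frac{d+1}{2}}_{\mathrm{rad}}(\mathbb B^{d+2}),\qquad \|(u_1,u_2)\|^2=\|u_1\|^2_{H^{\frac{d+3}{2}}_{\mathrm{rad}}}+\|u_2\|^2_{H^{\frac{d+1}{2}}_{\mathrm{rad}}},$$ and for $\delta>0$ let $\mathcal B_\delta=\{\mathbf u\in\mathcal H:\|\mathbf u\|\le\delta\}$. Put $\eta(z)=\sin(2z)-2z$ for $z\in\mathbb C$, $f_0(\rho)=2\arctan\big(\rho/\sqrt{d-2}\big)$, and,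 for $\mathbf u=(u_1,u_2)\in\mathcal H$ and $\rho\in(0,1)$, $$\mathbf N(\mathbf u)(\rho)=\Big(0,\,-\frac{d-1}{2}\,\frac{\eta(f_0(\rho)+\rho u_1(\rho))-\eta(f_0(\rho))-\eta'(f_0(\rho))\,\rho u_1(\rho)}{\rho^3}\Big).$$ **Lemma.** For every $\delta>0$ there is a constant $C>0$, depending only on $d$ and $\delta$, such that for all $\mathbf u,\mathbf v\in\mathcal B_\delta$ one has $\mathbf N(\mathbf u),\mathbf N(\mathbf v)\in\mathcal H$ and $$\|\mathbf N(\mathbf u)-\mathbf N(\mathbf v)\|\le C\,(\|\mathbf u\|+\|\mathbf v\|)\,\|\mathbf u-\mathbf v\|.$$ -/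

import Mathlib

open MeasureTheory
open scoped ContDiff

noncomputable section

namespace WaveMaps

/-! ### Sobolev spaces `H^m = W^{m,2}` on the open unit ball of `ℝⁿ` -/

/-- `ℝⁿ` with the Euclidean norm. -/
abbrev E (n : ℕ) : Type := EuclideanSpace ℝ (Fin n)

/-- The open unit ball `𝔹ⁿ`. -/
abbrev unitBall (n : ℕ) : Set (E n) := Metric.ball (0 : E n) 1

/-- Lebesgue measure on the open unit ball. -/
abbrev ballMeasure (n : ℕ) : Measure (E n) := volume.restrict (unitBall n)

/-- The classical partial derivative `∂_{w 0} ∂_{w 1} ⋯ ∂_{w (k-1)} φ` of order `k`, for an ordered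
list `w` of `k` coordinate directions. -/
def partialDeriv {n k : ℕ} (w : Fin k → Fin n) (φ : E n → ℝ) (x : E n) : ℝ :=
  iteratedFDeriv ℝ k φ x (fun j => EuclideanSpace.single (w j) (1 : ℝ))

/-- `g` is the weak derivative `∂_{w 0} ⋯ ∂_{w (k-1)} f` on the unit ball, tested against all
smooth functions with compact support in the ball. -/
def IsWeakDeriv {n k : ℕ} (w : Fin k → Fin n) (f g : E n → ℂ) : Prop :=
  ∀ φ : E n → ℝ, ContDiff ℝ ∞ φ → HasCompactSupport φ → tsupport φ ⊆ unitBall n →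
    ∫ x in unitBall n, partialDeriv w φ x • f x =
      (-1 : ℝ) ^ k • ∫ x in unitBall n, φ x • g x

/-- `f ∈ H^m(𝔹ⁿ)`: `f` and all its weak derivatives up to order `m` are in `L²(𝔹ⁿ)`. -/
def MemSobolev {n : ℕ} (m : ℕ) (f : E n → ℂ) : Prop :=
  MemLp f 2 (ballMeasure n) ∧
    ∀ k ≤ m, ∀ w : Fin k → Fin n, ∃ g : E n → ℂ, MemLp g 2 (ballMeasure n) ∧ IsWeakDeriv w f g

/-- Weak derivatives in `L²` are unique up to null sets. -/
theorem IsWeakDeriv.ae_eq {n k : ℕ} {w : Fin k → Fin n} {f g h : E n → ℂ}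
    (hg : MemLp g 2 (ballMeasure n)) (hh : MemLp h 2 (ballMeasure n))
    (hfg : IsWeakDeriv w f g) (hfh : IsWeakDeriv w f h) : g =ᵐ[ballMeasure n] h := by
  have : IsFiniteMeasure (ballMeasure n) :=
    ⟨by simpa using (measure_ball_lt_top (μ := volume) (x := (0 : E n)) (r := 1))⟩
  have hgi : Integrable g (ballMeasure n) := hg.integrable (by norm_num)
  have hhi : Integrable h (ballMeasure n) := hh.integrable (by norm_num)
  have hint : IntegrableOn (g - h) (unitBall n) volume := hgi.sub hhi
  have key := IsOpen.ae_eq_zero_of_integral_contDiff_smul_eq_zero (μ := volume)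
    (U := unitBall n) Metric.isOpen_ball hint.locallyIntegrableOn (by
      intro φ hφ hc hs
      obtain ⟨C, hC⟩ := hc.exists_bound_of_continuous hφ.continuous
      have hb : ∀ u : E n → ℂ, Integrable u (ballMeasure n) →
          Integrable (fun x => φ x • u x) (ballMeasure n) := fun u hu =>
        hu.bdd_smul C hφ.continuous.aestronglyMeasurable (Filter.Eventually.of_forall hC)
      have h1 : ∫ x, φ x • (g - h) x = ∫ x in unitBall n, φ x • (g - h) x := by
        refine (setIntegral_eq_integral_of_forall_compl_eq_zero ?_).symm
        intro x hx
        rw [image_eq_zero_of_notMem_tsupport (fun hx' => hx (hs hx')), zero_smul]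
      have h2 : ((-1 : ℝ) ^ k • ∫ x in unitBall n, φ x • g x) =
          (-1 : ℝ) ^ k • ∫ x in unitBall n, φ x • h x :=
        (hfg φ hφ hc hs).symm.trans (hfh φ hφ hc hs)
      have h3 := smul_right_injective ℂ (pow_ne_zero k (by norm_num : (-1 : ℝ) ≠ 0)) h2
      rw [h1]
      simp only [Pi.sub_apply, smul_sub]
      rw [integral_sub (hb g hgi) (hb h hhi), h3, sub_self])
  refine (ae_restrict_iff' Metric.isOpen_ball.measurableSet).2 ?_
  filter_upwards [key] with x hx hxb
  exact sub_eq_zero.1 (hx hxb)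

open Classical in
/-- The weak derivative of `f` as a function (well defined up to null sets; `0` if `f` has no such
weak derivative in `L²`). -/
def weakDeriv {n k : ℕ} (w : Fin k → Fin n) (f : E n → ℂ) : E n → ℂ :=
  if h : ∃ g : E n → ℂ, MemLp g 2 (ballMeasure n) ∧ IsWeakDeriv w f g then h.choose else 0

/-- The norm of `H^m(𝔹ⁿ)`: the square root of the sum of the squares of the `L²(𝔹ⁿ)` norms of all
partial derivatives of order at most `m`, i.e. of `∑_{k ≤ m} ‖∇^k f‖²` with the Euclidean norm of
the tensor `∇^k f`. -/
def sobolevNorm {n : ℕ} (m : ℕ) (f : E n → ℂ) : ℝ :=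
  Real.sqrt (∑ k ∈ Finset.range (m + 1), ∑ w : Fin k → Fin n,
    (eLpNorm (weakDeriv w f) 2 (ballMeasure n)).toReal ^ 2)

/-! ### Radial functions and the space `𝓗` -/

/-- The radial function `û(ξ) = u(|ξ|)` on `ℝⁿ` with profile `u`. -/
def radial (n : ℕ) (u : ℝ → ℂ) : E n → ℂ := fun ξ => u ‖ξ‖

/-- (Representatives of) the elements of
`𝓗 = H_rad^{(d+3)/2}(𝔹^{d+2}) × H_rad^{(d+1)/2}(𝔹^{d+2})`, `d` odd. -/
def stateSpace (d : ℕ) : Set ((ℝ → ℂ) × (ℝ → ℂ)) :=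
  {u | MemSobolev ((d + 3) / 2) (radial (d + 2) u.1) ∧
       MemSobolev ((d + 1) / 2) (radial (d + 2) u.2)}

/-- The norm of `𝓗`. -/
def stateNorm (d : ℕ) (u : (ℝ → ℂ) × (ℝ → ℂ)) : ℝ :=
  Real.sqrt (sobolevNorm ((d + 3) / 2) (radial (d + 2) u.1) ^ 2 +
    sobolevNorm ((d + 1) / 2) (radial (d + 2) u.2) ^ 2)

/-- The closed ball `𝓑_δ` of radius `δ` around zero in `𝓗`. -/
def stateBall (d : ℕ) (δ : ℝ) : Set ((ℝ → ℂ) × (ℝ → ℂ)) :=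
  {u | u ∈ stateSpace d ∧ stateNorm d u ≤ δ}

/-! ### The nonlinearity -/

/-- The profile `f₀(ρ) = 2 arctan (ρ / √(d-2))` of the self-similar blowup solution. -/
def f₀ (d : ℕ) (ρ : ℝ) : ℝ := 2 * Real.arctan (ρ / Real.sqrt ((d : ℝ) - 2))

/-- `η(z) = sin (2z) - 2z`. -/
def η (z : ℂ) : ℂ := Complex.sin (2 * z) - 2 * z

/-- The Taylor remainder `η(f₀(ρ) + z) - η(f₀(ρ)) - η'(f₀(ρ)) z`; the scalar nonlinearity is its
value at `z = ρ u₁(ρ)`. -/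
def taylorRemainder (d : ℕ) (ρ : ℝ) (z : ℂ) : ℂ :=
  η (f₀ d ρ + z) - η (f₀ d ρ) - deriv η (f₀ d ρ) * z

/-- The nonlinearity `𝐍(u)(ρ) = (0, -(d-1)/2 · N(ρ u₁(ρ)) / ρ³)`. -/
def nonlinearity (d : ℕ) (u : (ℝ → ℂ) × (ℝ → ℂ)) : (ℝ → ℂ) × (ℝ → ℂ) :=
  (fun _ => 0,
   fun ρ => -(((d : ℂ) - 1) / 2) * (taylorRemainder d ρ ((ρ : ℂ) * u.1 ρ) / (ρ : ℂ) ^ 3))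

end WaveMaps

end

noncomputable section
namespace WaveMaps

/-! ### One-dimensional weighted inequalities -/

/-! Put n = d + 2 and m = (d + 3) / 2, so that n + 1 = 2m. The estimate holds with room to spare:
the second component is locally Lipschitz from radial `H^m` into `H^m`, and one derivative is then
given away.

The addition theorem writes the Taylor remainder over ρ³ as (sin(2f₀)/ρ) (cos(2ρu) − 1)/ρ² +
cos(2f₀) (sin(2ρu) − 2ρu)/ρ³. Since f₀ is twice an arctangent, both coefficients are pole-free
rational functions of ρ², hence smooth and radial; the two quotients are everywhere convergent power
series in ρ² and u, starting at u² and u³ (`nonlinearity_snd_eq`). The singularity at the origin is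
gone, and what remains is that radial `H^m` is an algebra: differences of powers telescope, and
powers at least 2 leave the factor ‖u‖ + ‖v‖.

For the algebra property (`exists_smoothNorm_mul_le`), integration along rays gives |D^j f(x)| ≤ C
‖f‖ |x|^(1/2 − j) for 1 ≤ j < m, and boundedness of f (`exists_pointwise_bound`). In the Leibniz
rule the two end terms are a bounded function times an L² function, and all others are at most a
multiple of |x|^(1 − m), which is square integrable since 2(m − 1) < n.

All this is done for smooth radial functions. General data are contracted and mollified, which is
bounded in norm (`exists_smoothNorm_mollify_le`) and converges almost everywhere
(`ae_tendsto_mollify`); weak compactness in L² carries the bound to the limit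
(`exists_sobolevNorm_le_of_tendsto`). -/

theorem sq_intervalIntegral_mul_le {a b : ℝ} (hab : a ≤ b) {f g : ℝ → ℝ}
    (hf : ContinuousOn f (Set.Icc a b)) (hg : ContinuousOn g (Set.Icc a b)) :
    (∫ t in a..b, f t * g t) ^ 2 ≤ (∫ t in a..b, f t ^ 2) * ∫ t in a..b, g t ^ 2 := by
  rw [← Set.uIcc_of_le hab] at hf hg
  -- The quadratic s ↦ ∫ (f − s g)² is nonnegative; its discriminant gives Cauchy–Schwarz.
  have key : ∀ s : ℝ, 0 ≤ (∫ t in a..b, g t ^ 2) * (s * s) + (-2 * ∫ t in a..b, f t * g t) * s +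
      ∫ t in a..b, f t ^ 2 := by
    intro s
    have h1 : 0 ≤ ∫ t in a..b, (f t - s * g t) ^ 2 :=
      intervalIntegral.integral_nonneg hab fun t _ => sq_nonneg _
    have h2 : ∫ t in a..b, (f t - s * g t) ^ 2 =
        ∫ t in a..b, ((f t ^ 2 - (2 * s) * (f t * g t)) + (s * s) * g t ^ 2) := by
      congr 1; ext t; ring
    rw [h2, intervalIntegral.integral_add, intervalIntegral.integral_sub,
      intervalIntegral.integral_const_mul, intervalIntegral.integral_const_mul] at h1
    · linarith
    all_goals exact ContinuousOn.intervalIntegrable (by fun_prop)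
  have := discrim_le_zero key
  rw [discrim] at this
  nlinarith

theorem integral_rpow_tail_le {ρ a : ℝ} (hρ : 0 < ρ) (hρ1 : ρ ≤ 1) (ha : 1 / 2 ≤ a) :
    ∫ t in ρ..1, t ^ (-a - 1) ≤ 2 * ρ ^ (-a) := by
  have h0 : (0 : ℝ) ∉ Set.uIcc ρ 1 := by
    rw [Set.uIcc_of_le hρ1]; intro h; linarith [h.1]
  rw [integral_rpow (Or.inr ⟨by linarith, h0⟩)]
  have h1 : (1 : ℝ) ^ (-a - 1 + 1) = 1 := Real.one_rpow _
  have h2 : -a - 1 + 1 = -a := by ring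
  rw [h2, Real.one_rpow, div_le_iff_of_neg (by linarith)]
  have h3 : 0 < ρ ^ (-a) := Real.rpow_pos_of_pos hρ _
  nlinarith

theorem integral_inv_sqrt_tail_le {ρ : ℝ} (hρ : 0 < ρ) :
    ∫ t in ρ..1, t ^ (-(1 / 2) : ℝ) ≤ 2 := by
  rw [integral_rpow (Or.inl (by norm_num))]
  have h3 : 0 < ρ ^ ((-(1 / 2) : ℝ) + 1) := Real.rpow_pos_of_pos hρ _
  rw [Real.one_rpow]
  norm_num at h3 ⊢
  linarith

variable {m : ℕ} {M : ℝ} {H K : ℝ → ℝ}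

/-- On [1/2, 1] the weight is at least 4^(-(m - 1)), so there the weighted norm controls the plain
L² norm, and hence the L¹ norm. -/
theorem integral_half_le (hm : 1 ≤ m) (hM : 0 ≤ M) (hH : Continuous H)
    (hE : ∫ t in (0:ℝ)..1, t ^ (2 * m - 2) * H t ^ 2 ≤ M ^ 2) :
    ∫ t in (1 / 2 : ℝ)..1, H t ≤ 2 ^ (m - 1) * M := by
  have h1 := sq_intervalIntegral_mul_le (a := 1 / 2) (b := 1) (by norm_num)
    hH.continuousOn (continuousOn_const (c := (1 : ℝ)))
  have h2 : ∫ t in (1 / 2 : ℝ)..1, H t ^ 2 ≤ 4 ^ (m - 1) * M ^ 2 := by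
    calc ∫ t in (1 / 2 : ℝ)..1, H t ^ 2
        ≤ ∫ t in (1 / 2 : ℝ)..1, 4 ^ (m - 1) * (t ^ (2 * m - 2) * H t ^ 2) := by
          apply intervalIntegral.integral_mono_on (by norm_num)
            (Continuous.intervalIntegrable (by fun_prop) _ _)
            (Continuous.intervalIntegrable (by fun_prop) _ _)
          intro t ht
          have h4 : (1 : ℝ) ≤ 4 ^ (m - 1) * t ^ (2 * m - 2) := by
            rw [show 2 * m - 2 = 2 * (m - 1) by omega, pow_mul, ← mul_pow]
            exact one_le_pow₀ (by nlinarith [ht.1])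
          nlinarith [sq_nonneg (H t)]
      _ = 4 ^ (m - 1) * ∫ t in (1 / 2 : ℝ)..1, t ^ (2 * m - 2) * H t ^ 2 :=
          intervalIntegral.integral_const_mul _ _
      _ ≤ 4 ^ (m - 1) * ∫ t in (0 : ℝ)..1, t ^ (2 * m - 2) * H t ^ 2 := by
          gcongr
          apply intervalIntegral.integral_mono_interval (by norm_num) (by norm_num) le_rfl
          · refine (ae_restrict_iff' measurableSet_Ioc).2 (Filter.Eventually.of_forall ?_)
            intro t ht
            have := ht.1.le
            simp only [Pi.zero_apply]
            positivity
          · exact Continuous.intervalIntegrable (by fun_prop) _ _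
      _ ≤ _ := by gcongr
  simp only [mul_one, one_pow] at h1
  have h3 : ∫ t in (1 / 2 : ℝ)..1, (1:ℝ) = 1 / 2 := by norm_num
  rw [h3] at h1
  apply le_of_sq_le_sq _ (by positivity)
  calc _ ≤ (4 ^ (m - 1) * M ^ 2) * (1 / 2) := h1.trans (by gcongr)
    _ ≤ (2 ^ (m - 1) * M) ^ 2 := by
      rw [mul_pow, ← pow_mul, mul_comm (m - 1) 2, pow_mul]
      norm_num
      have : 0 ≤ (4:ℝ) ^ (m - 1) * M ^ 2 := by positivity
      linarith

/-- Average `hHK` over s in [1/2, 1]: the mean of `H` contributes two units of 2^(m - 1) M and the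
integral of `K` one more, whence the 3. -/
theorem boundary_value_le (hm : 1 ≤ m) (hM : 0 ≤ M) (hH : Continuous H) (hK : Continuous K)
    (hK0 : ∀ t, 0 ≤ K t)
    (hHK : ∀ s, 0 < s → s ≤ 1 → H 1 ≤ H s + ∫ t in s..1, K t)
    (hE : ∫ t in (0:ℝ)..1, t ^ (2 * m - 2) * H t ^ 2 ≤ M ^ 2)
    (hEK : ∫ t in (0:ℝ)..1, t ^ (2 * m - 2) * K t ^ 2 ≤ M ^ 2) :
    H 1 ≤ 3 * 2 ^ (m - 1) * M := by
  have h1 := integral_half_le hm hM hH hE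
  have h2 := integral_half_le hm hM hK hEK
  have h3 : ∫ s in (1 / 2 : ℝ)..1, H 1 ≤
      ∫ s in (1 / 2 : ℝ)..1, (H s + ∫ t in (1 / 2 : ℝ)..1, K t) := by
    apply intervalIntegral.integral_mono_on (by norm_num)
      (Continuous.intervalIntegrable (by fun_prop) _ _)
      (Continuous.intervalIntegrable (by fun_prop) _ _)
    intro s hs
    refine (hHK s (by linarith [hs.1]) hs.2).trans ?_
    gcongr
    exact intervalIntegral.integral_mono_interval hs.1 hs.2 le_rfl
      (Filter.Eventually.of_forall hK0) (hK.intervalIntegrable _ _)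
  rw [intervalIntegral.integral_add (hH.intervalIntegrable _ _)
    (Continuous.intervalIntegrable (by fun_prop) _ _)] at h3
  simp only [intervalIntegral.integral_const, smul_eq_mul] at h3
  nlinarith

/-- Cauchy–Schwarz for the factors t^(m - 1) K and t^(1 - m); the square integral of the latter over
[ρ, 1] is at most 2 ρ^(3 - 2m). -/
theorem integral_tail_le (hm : 2 ≤ m) (hM : 0 ≤ M) (hK : Continuous K)
    (hEK : ∫ t in (0:ℝ)..1, t ^ (2 * m - 2) * K t ^ 2 ≤ M ^ 2) {ρ : ℝ} (hρ : 0 < ρ)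
    (hρ1 : ρ ≤ 1) :
    ∫ t in ρ..1, K t ≤ 2 * M * ρ ^ (3 / 2 - (m : ℝ)) := by
  have hpos : ∀ t ∈ Set.Icc ρ 1, 0 < t := fun t ht => hρ.trans_le ht.1
  have hinv : ContinuousOn (fun t : ℝ => (t ^ (m - 1))⁻¹) (Set.Icc ρ 1) :=
    ContinuousOn.inv₀ (by fun_prop) fun t ht => (pow_pos (hpos t ht) _).ne'
  have h1 := sq_intervalIntegral_mul_le hρ1 (f := fun t => t ^ (m - 1) * K t)
    (g := fun t => (t ^ (m - 1))⁻¹) (by fun_prop) hinv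
  have e1 : ∫ t in ρ..1, t ^ (m - 1) * K t * (t ^ (m - 1))⁻¹ = ∫ t in ρ..1, K t := by
    apply intervalIntegral.integral_congr
    intro t ht
    rw [Set.uIcc_of_le hρ1] at ht
    have := (pow_pos (hpos t ht) (m - 1)).ne'
    field_simp
  have e2 : ∫ t in ρ..1, (t ^ (m - 1) * K t) ^ 2 ≤ M ^ 2 := by
    refine le_trans ?_ hEK
    have : (fun t => (t ^ (m - 1) * K t) ^ 2) = fun t => t ^ (2 * m - 2) * K t ^ 2 := by
      ext t; rw [mul_pow, ← pow_mul]; congr 2; omega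
    rw [this]
    apply intervalIntegral.integral_mono_interval hρ.le hρ1 le_rfl
    · refine (ae_restrict_iff' measurableSet_Ioc).2 (Filter.Eventually.of_forall ?_)
      intro t ht
      have := ht.1.le
      simp only [Pi.zero_apply]
      positivity
    · exact Continuous.intervalIntegrable (by fun_prop) _ _
  have hm' : (2 : ℝ) ≤ m := by exact_mod_cast hm
  have e3 : ∫ t in ρ..1, ((t ^ (m - 1))⁻¹) ^ 2 ≤ 2 * ρ ^ (3 - 2 * (m : ℝ)) := by
    have : ∫ t in ρ..1, ((t ^ (m - 1))⁻¹) ^ 2 = ∫ t in ρ..1, t ^ (-(2 * (m : ℝ) - 3) - 1) := by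
      apply intervalIntegral.integral_congr
      intro t ht
      rw [Set.uIcc_of_le hρ1] at ht
      simp only
      rw [show -(2 * (m : ℝ) - 3) - 1 = -(((2 * (m - 1) : ℕ) : ℝ)) by
        push_cast [Nat.cast_sub (show 1 ≤ m by omega)]; ring,
        Real.rpow_neg (hpos t ht).le, Real.rpow_natCast, inv_pow, ← pow_mul, mul_comm]
    rw [this]
    refine (integral_rpow_tail_le hρ hρ1 (by linarith)).trans_eq ?_
    congr 2; ring
  rw [e1] at h1
  have hp : 0 < ρ ^ (3 / 2 - (m : ℝ)) := Real.rpow_pos_of_pos hρ _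
  apply le_of_sq_le_sq _ (by positivity)
  have e4 : (ρ ^ (3 / 2 - (m : ℝ))) ^ 2 = ρ ^ (3 - 2 * (m : ℝ)) := by
    rw [← Real.rpow_natCast, ← Real.rpow_mul hρ.le]; congr 1; push_cast; ring
  calc _ ≤ M ^ 2 * (2 * ρ ^ (3 - 2 * (m : ℝ))) := h1.trans (by
          gcongr
          exact intervalIntegral.integral_nonneg hρ1 fun t _ => sq_nonneg _)
    _ ≤ _ := by
      rw [mul_pow, e4]
      have : 0 ≤ M ^ 2 * ρ ^ (3 - 2 * (m : ℝ)) := by positivity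
      linarith

/-- Pointwise bounds for a chain of functions each of which controls the variation of the previous
one, in terms of the weighted `L²` norms with weight `t ^ (2 m - 2)`. -/
theorem exists_chain_bound (hm : 2 ≤ m) : ∃ C : ℝ, 0 < C ∧ ∀ (H : ℕ → ℝ → ℝ) (M : ℝ), 0 ≤ M →
    (∀ j, Continuous (H j)) → (∀ j t, 0 ≤ H j t) →
    (∀ j ρ s, 0 < ρ → ρ ≤ s → s ≤ 1 → |H j s - H j ρ| ≤ ∫ t in ρ..s, H (j + 1) t) →
    (∀ j ≤ m, ∫ t in (0:ℝ)..1, t ^ (2 * m - 2) * H j t ^ 2 ≤ M ^ 2) →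
    (∀ j, 1 ≤ j → j < m → ∀ ρ, 0 < ρ → ρ ≤ 1 → H j ρ ≤ C * M * ρ ^ (1 / 2 - (j : ℝ))) ∧
    ∀ ρ, 0 < ρ → ρ ≤ 1 → H 0 ρ ≤ C * M := by
  set c : ℝ := 3 * 2 ^ (m - 1) with hc
  have hc1 : 1 ≤ c := by
    have : (1 : ℝ) ≤ 2 ^ (m - 1) := one_le_pow₀ (by norm_num)
    linarith
  -- Downward induction on j, with i = m − 1 − j. The top case is the tail estimate; each further
  -- integration from the boundary raises the exponent by one.
  have main : ∀ i : ℕ, ∃ C : ℝ, 0 < C ∧ ∀ (H : ℕ → ℝ → ℝ) (M : ℝ), 0 ≤ M →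
      (∀ j, Continuous (H j)) → (∀ j t, 0 ≤ H j t) →
      (∀ j ρ s, 0 < ρ → ρ ≤ s → s ≤ 1 → |H j s - H j ρ| ≤ ∫ t in ρ..s, H (j + 1) t) →
      (∀ j ≤ m, ∫ t in (0:ℝ)..1, t ^ (2 * m - 2) * H j t ^ 2 ≤ M ^ 2) →
      ∀ j, 1 ≤ j → j + 1 + i = m → ∀ ρ, 0 < ρ → ρ ≤ 1 →
        H j ρ ≤ C * M * ρ ^ (1 / 2 - (j : ℝ)) := by
    intro i
    induction i with
    | zero =>
      refine ⟨c + 2, by linarith, fun H M hM hcont hpos hvar hE j hj1 hj ρ hρ hρ1 => ?_⟩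
      have hb := boundary_value_le (by omega) hM (hcont j) (hcont (j + 1)) (hpos (j + 1))
        (fun s hs hs1 => by linarith [(abs_le.1 (hvar j s 1 hs hs1 le_rfl)).2])
        (hE j (by omega)) (hE (j + 1) (by omega))
      have ht := integral_tail_le hm hM (hcont (j + 1)) (hE (j + 1) (by omega)) hρ hρ1
      have hv := (abs_le.1 (hvar j ρ 1 hρ hρ1 le_rfl)).1
      have he : (3 / 2 - (m : ℝ)) = 1 / 2 - j := by rw [← hj]; push_cast; ring
      rw [he] at ht
      have h1 : 1 ≤ ρ ^ (1 / 2 - (j : ℝ)) := by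
        apply Real.one_le_rpow_of_pos_of_le_one_of_nonpos hρ hρ1
        have : (1 : ℝ) ≤ j := by exact_mod_cast hj1
        linarith
      have : c * M ≤ c * M * ρ ^ (1 / 2 - (j : ℝ)) := le_mul_of_one_le_right (by positivity) h1
      nlinarith
    | succ i ih =>
      obtain ⟨C, hC, ih⟩ := ih
      refine ⟨c + 2 * C, by linarith, fun H M hM hcont hpos hvar hE j hj1 hj ρ hρ hρ1 => ?_⟩
      have hb := boundary_value_le (by omega) hM (hcont j) (hcont (j + 1)) (hpos (j + 1))
        (fun s hs hs1 => by linarith [(abs_le.1 (hvar j s 1 hs hs1 le_rfl)).2])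
        (hE j (by omega)) (hE (j + 1) (by omega))
      have hj1' : (1 : ℝ) ≤ j := by exact_mod_cast hj1
      have hv := (abs_le.1 (hvar j ρ 1 hρ hρ1 le_rfl)).1
      have hI : ∫ t in ρ..1, H (j + 1) t ≤ C * M * (2 * ρ ^ (1 / 2 - (j : ℝ))) := by
        calc _ ≤ ∫ t in ρ..1, C * M * t ^ (-((j : ℝ) - 1 / 2) - 1) := by
              apply intervalIntegral.integral_mono_on hρ1 ((hcont _).intervalIntegrable _ _)
              · apply ContinuousOn.intervalIntegrable
                rw [Set.uIcc_of_le hρ1]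
                exact continuousOn_const.mul (continuousOn_id.rpow_const
                  fun t ht => Or.inl (hρ.trans_le ht.1).ne')
              · intro t ht
                refine (ih H M hM hcont hpos hvar hE (j + 1) (by omega) (by omega) t
                  (hρ.trans_le ht.1) ht.2).trans_eq ?_
                congr 2; push_cast; ring
          _ = C * M * ∫ t in ρ..1, t ^ (-((j : ℝ) - 1 / 2) - 1) :=
              intervalIntegral.integral_const_mul _ _
          _ ≤ C * M * (2 * ρ ^ (-((j : ℝ) - 1 / 2))) := by
              gcongr
              exact integral_rpow_tail_le hρ hρ1 (by linarith)
          _ = _ := by congr 3; ring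
      have h1 : 1 ≤ ρ ^ (1 / 2 - (j : ℝ)) := by
        apply Real.one_le_rpow_of_pos_of_le_one_of_nonpos hρ hρ1
        linarith
      have : c * M ≤ c * M * ρ ^ (1 / 2 - (j : ℝ)) := le_mul_of_one_le_right (by positivity) h1
      nlinarith
  choose D hD hmain using main
  set C : ℝ := ∑ i ∈ Finset.range m, D i with hCdef
  have hDC : ∀ i < m, D i ≤ C := fun i hi =>
    Finset.single_le_sum (f := D) (fun i _ => (hD i).le) (Finset.mem_range.2 hi)
  have hC : 0 < C := (hD 0).trans_le (hDC 0 (by omega))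
  refine ⟨c + 2 * C, by linarith, fun H M hM hcont hpos hvar hE => ?_⟩
  have hpt : ∀ j, 1 ≤ j → j < m → ∀ ρ, 0 < ρ → ρ ≤ 1 →
      H j ρ ≤ C * M * ρ ^ (1 / 2 - (j : ℝ)) := by
    intro j hj1 hj ρ hρ hρ1
    refine (hmain (m - 1 - j) H M hM hcont hpos hvar hE j hj1 (by omega) ρ hρ hρ1).trans ?_
    gcongr
    exact hDC _ (by omega)
  refine ⟨fun j hj1 hj ρ hρ hρ1 => (hpt j hj1 hj ρ hρ hρ1).trans (by gcongr; linarith), ?_⟩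
  intro ρ hρ hρ1
  have hb := boundary_value_le (by omega) hM (hcont 0) (hcont 1) (hpos 1)
    (fun s hs hs1 => by linarith [(abs_le.1 (hvar 0 s 1 hs hs1 le_rfl)).2])
    (hE 0 (by omega)) (hE 1 (by omega))
  have hv := (abs_le.1 (hvar 0 ρ 1 hρ hρ1 le_rfl)).1
  -- For j = 0 the integrand is of order t^(-1/2), integrable at the origin, so no negative power of
  -- ρ appears.
  have hI : ∫ t in ρ..1, H 1 t ≤ C * M * 2 := by
    calc _ ≤ ∫ t in ρ..1, C * M * t ^ (-(1 / 2) : ℝ) := by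
          apply intervalIntegral.integral_mono_on hρ1 ((hcont _).intervalIntegrable _ _)
          · apply ContinuousOn.intervalIntegrable
            rw [Set.uIcc_of_le hρ1]
            exact continuousOn_const.mul (continuousOn_id.rpow_const
              fun t ht => Or.inl (hρ.trans_le ht.1).ne')
          · intro t ht
            refine (hpt 1 le_rfl (by omega) t (hρ.trans_le ht.1) ht.2).trans_eq ?_
            congr 2; push_cast; ring
      _ = C * M * ∫ t in ρ..1, t ^ (-(1 / 2) : ℝ) := intervalIntegral.integral_const_mul _ _
      _ ≤ _ := by gcongr; exact integral_inv_sqrt_tail_le hρ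
  simp only [zero_add] at hv
  nlinarith

end WaveMaps
end

noncomputable section
namespace WaveMaps

/-! ### Smooth radial functions -/

instance (n : ℕ) : IsFiniteMeasure (ballMeasure n) :=
  ⟨by simpa using (measure_ball_lt_top (μ := volume) (x := (0 : E n)) (r := 1))⟩

/-- Smooth functions on `ℝⁿ` that are invariant under all linear isometries. -/
structure IsSmoothRadial {n : ℕ} (f : E n → ℂ) : Prop where
  contDiff : ContDiff ℝ ∞ f
  comp_isometry : ∀ R : E n ≃ₗᵢ[ℝ] E n, f ∘ R = f

variable {n m : ℕ} {f g : E n → ℂ}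

theorem exists_isometry_map {x y : E n} (h : ‖x‖ = ‖y‖) : ∃ R : E n ≃ₗᵢ[ℝ] E n, R x = y :=
  ⟨_, Submodule.reflection_sub h⟩

/-- A reflection maps one point of a sphere to any other, and isometries preserve the norm of the
derivative tensor. Hence that norm is radial, without any computation in polar coordinates. -/
theorem IsSmoothRadial.norm_iteratedFDeriv_eq (hf : IsSmoothRadial f) (j : ℕ) {x y : E n}
    (h : ‖x‖ = ‖y‖) : ‖iteratedFDeriv ℝ j f x‖ = ‖iteratedFDeriv ℝ j f y‖ := by
  obtain ⟨R, rfl⟩ := exists_isometry_map h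
  rw [← R.norm_iteratedFDeriv_comp_right f x j, hf.comp_isometry]

theorem IsSmoothRadial.continuous_iteratedFDeriv (hf : IsSmoothRadial f) (j : ℕ) :
    Continuous (iteratedFDeriv ℝ j f) :=
  hf.contDiff.continuous_iteratedFDeriv (by exact_mod_cast le_top)

theorem IsSmoothRadial.add (hf : IsSmoothRadial f) (hg : IsSmoothRadial g) :
    IsSmoothRadial (f + g) :=
  ⟨hf.1.add hg.1, fun R => by rw [Pi.add_comp, hf.2, hg.2]⟩

theorem IsSmoothRadial.sub (hf : IsSmoothRadial f) (hg : IsSmoothRadial g) :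
    IsSmoothRadial (f - g) :=
  ⟨hf.1.sub hg.1, fun R => by rw [Pi.sub_comp, hf.2, hg.2]⟩

theorem IsSmoothRadial.mul (hf : IsSmoothRadial f) (hg : IsSmoothRadial g) :
    IsSmoothRadial (f * g) :=
  ⟨hf.1.mul hg.1, fun R => by rw [Pi.mul_comp, hf.2, hg.2]⟩

theorem isSmoothRadial_const (c : ℂ) : IsSmoothRadial (fun _ : E n => c) :=
  ⟨contDiff_const, fun _ => rfl⟩

theorem IsSmoothRadial.const_smul (hf : IsSmoothRadial f) (c : ℂ) : IsSmoothRadial (c • f) :=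
  (isSmoothRadial_const c).mul hf

theorem IsSmoothRadial.pow (hf : IsSmoothRadial f) (k : ℕ) : IsSmoothRadial (f ^ k) := by
  induction k with
  | zero => rw [pow_zero]; exact isSmoothRadial_const 1
  | succ k ih => rw [pow_succ]; exact ih.mul hf

theorem IsSmoothRadial.sum {ι : Type*} {s : Finset ι} {F : ι → E n → ℂ}
    (h : ∀ i ∈ s, IsSmoothRadial (F i)) : IsSmoothRadial (∑ i ∈ s, F i) := by
  classical
  induction s using Finset.induction_on with
  | empty => rw [Finset.sum_empty]; exact isSmoothRadial_const 0
  | insert a s ha ih =>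
    rw [Finset.sum_insert ha]
    exact (h a (by simp)).add (ih fun i hi => h i (by simp [hi]))

/-! ### `L²` norms on the ball -/

theorem memLp_ball_of_continuous {F : Type*} [NormedAddCommGroup F] {h : E n → F}
    (hh : Continuous h) : MemLp h 2 (ballMeasure n) := by
  obtain ⟨C, hC⟩ := (isCompact_closedBall (0 : E n) 1).exists_bound_of_continuousOn
    hh.continuousOn
  refine MemLp.of_bound hh.aestronglyMeasurable C ?_
  refine (ae_restrict_iff' measurableSet_ball).2 (Filter.Eventually.of_forall fun x hx => ?_)
  exact hC x (Metric.ball_subset_closedBall hx)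

theorem toReal_eLpNorm_sq {F α : Type*} [NormedAddCommGroup F] [MeasurableSpace α]
    {μ : Measure α} {h : α → F} (hh : MemLp h 2 μ) :
    (eLpNorm h 2 μ).toReal ^ 2 = ∫ x, ‖h x‖ ^ 2 ∂μ := by
  rw [hh.eLpNorm_eq_integral_rpow_norm (by norm_num) (by norm_num)]
  have h0 : 0 ≤ ∫ x, ‖h x‖ ^ 2 ∂μ := integral_nonneg fun x => by positivity
  have : (ENNReal.toReal 2) = 2 := by norm_num
  simp only [this, Real.rpow_ofNat]
  rw [ENNReal.toReal_ofReal (by positivity), ← Real.rpow_natCast, ← Real.rpow_mul h0]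
  norm_num

theorem toReal_eLpNorm_add_le {F α : Type*} [NormedAddCommGroup F] [MeasurableSpace α]
    {μ : Measure α} {h k : α → F} (hh : MemLp h 2 μ) (hk : MemLp k 2 μ) :
    (eLpNorm (h + k) 2 μ).toReal ≤ (eLpNorm h 2 μ).toReal + (eLpNorm k 2 μ).toReal := by
  rw [← ENNReal.toReal_add hh.eLpNorm_ne_top hk.eLpNorm_ne_top]
  exact ENNReal.toReal_mono (by simp [hh.eLpNorm_ne_top, hk.eLpNorm_ne_top])
    (eLpNorm_add_le hh.1 hk.1 (by norm_num))

theorem toReal_eLpNorm_sum_le {F α ι : Type*} [NormedAddCommGroup F] [MeasurableSpace α]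
    {μ : Measure α} (s : Finset ι) {h : ι → α → F} (hh : ∀ i ∈ s, MemLp (h i) 2 μ) :
    (eLpNorm (∑ i ∈ s, h i) 2 μ).toReal ≤ ∑ i ∈ s, (eLpNorm (h i) 2 μ).toReal := by
  rw [← ENNReal.toReal_sum fun i hi => (hh i hi).eLpNorm_ne_top]
  exact ENNReal.toReal_mono (ENNReal.sum_ne_top.2 fun i hi => (hh i hi).eLpNorm_ne_top)
    (eLpNorm_sum_le (fun i hi => (hh i hi).1) (by norm_num))

theorem toReal_eLpNorm_const_mul {α : Type*} [MeasurableSpace α] {μ : Measure α} {h : α → ℝ}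
    {c : ℝ} (hc : 0 ≤ c) :
    (eLpNorm (fun x => c * h x) 2 μ).toReal = c * (eLpNorm h 2 μ).toReal := by
  have : (fun x => c * h x) = c • h := rfl
  rw [this, eLpNorm_const_smul, ENNReal.toReal_mul]
  simp [abs_of_nonneg hc]

theorem toReal_eLpNorm_mono_ae {F G α : Type*} [NormedAddCommGroup F] [NormedAddCommGroup G]
    [MeasurableSpace α] {μ : Measure α} {h : α → F} {k : α → G} (hk : MemLp k 2 μ)
    (hle : ∀ᵐ x ∂μ, ‖h x‖ ≤ ‖k x‖) : (eLpNorm h 2 μ).toReal ≤ (eLpNorm k 2 μ).toReal :=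
  ENNReal.toReal_mono hk.eLpNorm_ne_top (eLpNorm_mono_ae hle)

/-- The `L²` norm on the ball of the full derivative of order `j`. -/
def derivNorm (j : ℕ) (f : E n → ℂ) : ℝ :=
  (eLpNorm (iteratedFDeriv ℝ j f) 2 (ballMeasure n)).toReal

/-- The Sobolev norm of order `m` of a smooth function on the ball. -/
def smoothNorm (m : ℕ) (f : E n → ℂ) : ℝ := ∑ j ∈ Finset.range (m + 1), derivNorm j f

theorem derivNorm_nonneg (j : ℕ) (f : E n → ℂ) : 0 ≤ derivNorm j f := ENNReal.toReal_nonneg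

theorem smoothNorm_nonneg (m : ℕ) (f : E n → ℂ) : 0 ≤ smoothNorm m f :=
  Finset.sum_nonneg fun j _ => derivNorm_nonneg j f

theorem derivNorm_le_smoothNorm {j : ℕ} (hj : j ≤ m) (f : E n → ℂ) :
    derivNorm j f ≤ smoothNorm m f :=
  Finset.single_le_sum (f := fun j => derivNorm j f) (fun j _ => derivNorm_nonneg j f)
    (Finset.mem_range.2 (by omega))

theorem IsSmoothRadial.memLp_iteratedFDeriv (hf : IsSmoothRadial f) (j : ℕ) :
    MemLp (iteratedFDeriv ℝ j f) 2 (ballMeasure n) :=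
  memLp_ball_of_continuous (hf.continuous_iteratedFDeriv j)

theorem IsSmoothRadial.smoothNorm_add_le (hf : IsSmoothRadial f) (hg : IsSmoothRadial g) :
    smoothNorm m (f + g) ≤ smoothNorm m f + smoothNorm m g := by
  rw [smoothNorm, smoothNorm, smoothNorm, ← Finset.sum_add_distrib]
  refine Finset.sum_le_sum fun j _ => ?_
  have : iteratedFDeriv ℝ j (f + g) = iteratedFDeriv ℝ j f + iteratedFDeriv ℝ j g :=
    iteratedFDeriv_add (hf.1.of_le (by exact_mod_cast le_top))
      (hg.1.of_le (by exact_mod_cast le_top))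
  rw [derivNorm, this]
  exact toReal_eLpNorm_add_le (hf.memLp_iteratedFDeriv j) (hg.memLp_iteratedFDeriv j)

theorem IsSmoothRadial.smoothNorm_const_smul (hf : IsSmoothRadial f) (c : ℂ) :
    smoothNorm m (c • f) = ‖c‖ * smoothNorm m f := by
  rw [smoothNorm, smoothNorm, Finset.mul_sum]
  refine Finset.sum_congr rfl fun j _ => ?_
  have : iteratedFDeriv ℝ j (c • f) = c • iteratedFDeriv ℝ j f := by
    ext1 x
    exact iteratedFDeriv_const_smul_apply (hf.1.of_le (by exact_mod_cast le_top)).contDiffAt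
  rw [derivNorm, this, eLpNorm_const_smul, ENNReal.toReal_mul, derivNorm]
  simp

theorem smoothNorm_zero : smoothNorm m (0 : E n → ℂ) = 0 := by
  have := (isSmoothRadial_const (n := n) 0).smoothNorm_const_smul (m := m) 0
  simpa using this

theorem IsSmoothRadial.smoothNorm_sum_le {ι : Type*} (s : Finset ι) {F : ι → E n → ℂ}
    (h : ∀ i, IsSmoothRadial (F i)) :
    smoothNorm m (∑ i ∈ s, F i) ≤ ∑ i ∈ s, smoothNorm m (F i) := by
  classical
  induction s using Finset.induction_on with
  | empty => simp [smoothNorm_zero]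
  | insert a s ha ih =>
    rw [Finset.sum_insert ha, Finset.sum_insert ha]
    exact ((h a).smoothNorm_add_le (IsSmoothRadial.sum fun i _ => h i)).trans (by gcongr)

/-! ### Pointwise bounds -/

theorem setIntegral_ball_norm [Nontrivial (E n)] (h : ℝ → ℝ) :
    ∫ x in unitBall n, h ‖x‖ =
      (n * (volume : Measure (E n)).real (unitBall n)) * ∫ t in (0:ℝ)..1, t ^ (n - 1) * h t := by
  have h1 : ∫ x in unitBall n, h ‖x‖ = ∫ x : E n, (Set.Iio 1).indicator h ‖x‖ := by
    rw [← integral_indicator measurableSet_ball]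
    congr 1; ext x
    by_cases hx : ‖x‖ < 1 <;> simp [Set.indicator, hx]
  rw [h1, integral_fun_norm_addHaar volume, finrank_euclideanSpace_fin, nsmul_eq_mul, smul_eq_mul,
    ← mul_assoc]
  congr 1
  rw [intervalIntegral.integral_of_le zero_le_one, integral_Ioc_eq_integral_Ioo,
    ← integral_indicator measurableSet_Ioo, ← integral_indicator measurableSet_Ioi]
  congr 1; ext t
  by_cases h0 : 0 < t <;> by_cases h1 : t < 1 <;> simp [Set.indicator, h0, h1]

theorem volume_unitBall_pos : 0 < (volume : Measure (E n)).real (unitBall n) :=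
  ENNReal.toReal_pos (Metric.measure_ball_pos volume _ one_pos).ne' measure_ball_lt_top.ne

/-- Pointwise bounds of smooth radial functions and their derivatives on the ball. -/
theorem exists_pointwise_bound (hm : 2 ≤ m) (hn : n + 1 = 2 * m) : ∃ C : ℝ, 0 < C ∧
    ∀ f : E n → ℂ, IsSmoothRadial f → ∀ x : E n, x ≠ 0 → ‖x‖ ≤ 1 →
      (∀ j, 1 ≤ j → j < m →
        ‖iteratedFDeriv ℝ j f x‖ ≤ C * smoothNorm m f * ‖x‖ ^ (1 / 2 - (j : ℝ))) ∧
      ‖f x‖ ≤ C * smoothNorm m f := by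
  obtain ⟨C, hC, hmain⟩ := exists_chain_bound hm
  have hn0 : 0 < n := by omega
  have : Nonempty (Fin n) := ⟨⟨0, hn0⟩⟩
  have hnt : Nontrivial (E n) := inferInstance
  set c : ℝ := n * (volume : Measure (E n)).real (unitBall n) with hc
  have hcpos : 0 < c := mul_pos (by exact_mod_cast hn0) volume_unitBall_pos
  -- Squared L² norms on the ball are `c` times weighted integrals over [0, 1], so the chain bound
  -- is applied with M equal to the Sobolev norm over √c.
  refine ⟨C / Real.sqrt c, by positivity, fun f hf x hx0 hx1 => ?_⟩
  obtain ⟨e, he⟩ : ∃ e : E n, ‖e‖ = 1 := exists_norm_eq _ zero_le_one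
  -- The norms along a single ray determine the norms everywhere, and the variation of each along
  -- the ray is controlled by the next one.
  set H : ℕ → ℝ → ℝ := fun j t => ‖iteratedFDeriv ℝ j f (t • e)‖ with hH
  have hHx : ∀ j (y : E n), ‖iteratedFDeriv ℝ j f y‖ = H j ‖y‖ := fun j y =>
    hf.norm_iteratedFDeriv_eq j (by simp [norm_smul, he])
  have hcont : ∀ j, Continuous (H j) := fun j =>
    ((hf.continuous_iteratedFDeriv j).comp (by fun_prop)).norm
  have hvar : ∀ j ρ s, 0 < ρ → ρ ≤ s → s ≤ 1 →
      |H j s - H j ρ| ≤ ∫ t in ρ..s, H (j + 1) t := by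
    intro j ρ s _ hρs _
    have hd : ∀ t, HasDerivAt (fun t : ℝ => iteratedFDeriv ℝ j f (t • e))
        (fderiv ℝ (iteratedFDeriv ℝ j f) (t • e) e) t := by
      intro t
      have h1 : DifferentiableAt ℝ (iteratedFDeriv ℝ j f) (t • e) :=
        (hf.1.differentiable_iteratedFDeriv (m := j)
          (by exact_mod_cast ENat.natCast_lt_top j)) _
      have h2 : HasDerivAt (fun t : ℝ => t • e) e t := by
        simpa using (hasDerivAt_id t).smul_const e
      exact h1.hasFDerivAt.comp_hasDerivAt t h2
    have hle : ∀ t, ‖fderiv ℝ (iteratedFDeriv ℝ j f) (t • e) e‖ ≤ H (j + 1) t := by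
      intro t
      refine (ContinuousLinearMap.le_opNorm _ _).trans_eq ?_
      rw [he, mul_one, norm_fderiv_iteratedFDeriv]
    have hfc : Continuous fun t : ℝ => fderiv ℝ (iteratedFDeriv ℝ j f) (t • e) e := by
      have : Continuous (fderiv ℝ (iteratedFDeriv ℝ j f)) := by
        apply ContDiff.continuous_fderiv (n := 1) _ (by norm_num)
        exact hf.1.iteratedFDeriv_right (by exact_mod_cast le_top)
      exact (this.comp (by fun_prop : Continuous fun t : ℝ => t • e)).clm_apply continuous_const
    have := intervalIntegral.integral_eq_sub_of_hasDerivAt (fun t _ => hd t)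
      (hfc.intervalIntegrable ρ s)
    refine (abs_norm_sub_norm_le _ _).trans ?_
    rw [← this]
    refine intervalIntegral.norm_integral_le_of_norm_le hρs ?_ ((hcont _).intervalIntegrable _ _)
    exact Filter.Eventually.of_forall fun t _ => hle t
  have hE : ∀ j ≤ m, ∫ t in (0:ℝ)..1, t ^ (2 * m - 2) * H j t ^ 2 ≤
      (smoothNorm m f / Real.sqrt c) ^ 2 := by
    intro j hj
    have h1 := setIntegral_ball_norm (n := n) (fun t => H j t ^ 2)
    have h2 := toReal_eLpNorm_sq (hf.memLp_iteratedFDeriv j)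
    simp only [hHx] at h2
    rw [h1, ← hc, show n - 1 = 2 * m - 2 by omega] at h2
    rw [div_pow, Real.sq_sqrt hcpos.le, le_div_iff₀' hcpos, ← h2]
    exact pow_le_pow_left₀ ENNReal.toReal_nonneg (derivNorm_le_smoothNorm hj f) 2
  obtain ⟨h1, h2⟩ := hmain H (smoothNorm m f / Real.sqrt c)
    (div_nonneg (smoothNorm_nonneg _ _) (Real.sqrt_nonneg _)) hcont (fun j t => norm_nonneg _)
    hvar hE
  refine ⟨fun j hj1 hj => ?_, ?_⟩
  · rw [hHx]
    exact (h1 j hj1 hj _ (norm_pos_iff.2 hx0) hx1).trans_eq (by ring)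
  · have := hHx 0 x
    rw [norm_iteratedFDeriv_zero] at this
    rw [this]
    exact (h2 _ (norm_pos_iff.2 hx0) hx1).trans_eq (by ring)

/-! ### The algebra property -/

/-- In polar coordinates the Jacobian t^(2m - 2) cancels the square of t^(1 - m) exactly. -/
theorem memLp_norm_rpow_ball (hm : 2 ≤ m) (hn : n + 1 = 2 * m) :
    MemLp (fun x : E n => ‖x‖ ^ (1 - (m : ℝ))) 2 (ballMeasure n) := by
  have : Nonempty (Fin n) := ⟨⟨0, by omega⟩⟩
  rw [memLp_two_iff_integrable_sq
    (measurable_norm.pow_const (1 - (m : ℝ))).aestronglyMeasurable]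
  have := (integrableOn_fun_norm_addHaar (E := E n) volume (r := 1)
    (f := fun t : ℝ => (t ^ (1 - (m : ℝ))) ^ 2)).2 ?_
  · exact this
  · refine IntegrableOn.congr_fun (f := fun _ => (1 : ℝ)) (by simp) ?_ measurableSet_Ioo
    intro t ht
    have ht0 : 0 < t := ht.1
    simp only [finrank_euclideanSpace_fin, smul_eq_mul]
    rw [← Real.rpow_natCast, ← Real.rpow_natCast, ← Real.rpow_mul ht0.le, ← Real.rpow_add ht0,
      show n - 1 = 2 * m - 2 by omega, Nat.cast_sub (by omega)]
    push_cast
    rw [show 2 * (m : ℝ) - 2 + (1 - m) * 2 = 0 by ring, Real.rpow_zero]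

theorem ae_ball_ne_zero [Nontrivial (E n)] : ∀ᵐ x ∂(ballMeasure n), x ≠ 0 ∧ ‖x‖ < 1 := by
  refine (ae_restrict_iff' measurableSet_ball).2 ?_
  have : ∀ᵐ x : E n, x ≠ 0 := by
    simp [ae_iff]
  filter_upwards [this] with x hx hxb
  exact ⟨hx, by simpa using hxb⟩

/-- In a Leibniz term with 0 < j < i both factors obey the pointwise bounds, and the exponents add
up to 1 − i ≥ 1 − m. The two end terms keep the derivative of order i and use only boundedness of
the other factor. -/
theorem exists_leibniz_bound (hm : 2 ≤ m) (hn : n + 1 = 2 * m) : ∃ C : ℝ, 0 < C ∧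
    ∀ f g : E n → ℂ, IsSmoothRadial f → IsSmoothRadial g → ∀ i ≤ m, ∀ x : E n, x ≠ 0 → ‖x‖ < 1 →
      ‖iteratedFDeriv ℝ i (f * g) x‖ ≤ (C * smoothNorm m f) * ‖iteratedFDeriv ℝ i g x‖ +
        (C * smoothNorm m g) * ‖iteratedFDeriv ℝ i f x‖ +
        (C * smoothNorm m f * smoothNorm m g) * ‖x‖ ^ (1 - (m : ℝ)) := by
  obtain ⟨C, hC, hpt⟩ := exists_pointwise_bound hm hn
  refine ⟨2 ^ m * (C + C ^ 2), by positivity, fun f g hf hg i him x hx0 hx1 => ?_⟩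
  set a := smoothNorm m f
  set b := smoothNorm m g
  have ha : 0 ≤ a := smoothNorm_nonneg _ _
  have hb : 0 ≤ b := smoothNorm_nonneg _ _
  -- One constant above both `C` (end terms) and `C ^ 2` (intermediate terms).
  set D := C + C ^ 2 with hD
  have hCD : C ≤ D := by nlinarith
  have hCD2 : C ^ 2 ≤ D := by nlinarith
  have hxp : 0 < ‖x‖ := norm_pos_iff.2 hx0
  obtain ⟨hf1, hf0⟩ := hpt f hf x hx0 hx1.le
  obtain ⟨hg1, hg0⟩ := hpt g hg x hx0 hx1.le
  have hL := norm_iteratedFDeriv_mul_le hf.1 hg.1 x (n := i) (by exact_mod_cast le_top)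
  have hX : 0 ≤ ‖x‖ ^ (1 - (m : ℝ)) := by positivity
  have p1 : 0 ≤ D * a * ‖iteratedFDeriv ℝ i g x‖ := by positivity
  have p2 : 0 ≤ D * b * ‖iteratedFDeriv ℝ i f x‖ := by positivity
  have p3 : 0 ≤ D * a * b * ‖x‖ ^ (1 - (m : ℝ)) := by positivity
  have hterm : ∀ j ∈ Finset.range (i + 1),
      (i.choose j : ℝ) * ‖iteratedFDeriv ℝ j f x‖ * ‖iteratedFDeriv ℝ (i - j) g x‖ ≤
      (i.choose j : ℝ) * (D * a * ‖iteratedFDeriv ℝ i g x‖ +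
        D * b * ‖iteratedFDeriv ℝ i f x‖ + D * a * b * ‖x‖ ^ (1 - (m : ℝ))) := by
    intro j hj
    have hji : j ≤ i := by simpa [Nat.lt_succ_iff] using hj
    rw [mul_assoc]
    refine mul_le_mul_of_nonneg_left ?_ (Nat.cast_nonneg _)
    rcases Nat.eq_zero_or_pos j with rfl | hj0
    · rw [norm_iteratedFDeriv_zero, Nat.sub_zero]
      have : ‖f x‖ * ‖iteratedFDeriv ℝ i g x‖ ≤ D * a * ‖iteratedFDeriv ℝ i g x‖ := by
        gcongr; exact hf0.trans (by gcongr)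
      linarith
    rcases hji.eq_or_lt with rfl | hji
    · rw [Nat.sub_self, norm_iteratedFDeriv_zero, mul_comm]
      have : ‖g x‖ * ‖iteratedFDeriv ℝ j f x‖ ≤ D * b * ‖iteratedFDeriv ℝ j f x‖ := by
        gcongr; exact hg0.trans (by gcongr)
      linarith
    have q1 := hf1 j hj0 (by omega)
    have q2 := hg1 (i - j) (by omega) (by omega)
    have q3 := mul_le_mul q1 q2 (norm_nonneg _) (by positivity)
    have q4 : C * a * ‖x‖ ^ (1 / 2 - (j : ℝ)) * (C * b * ‖x‖ ^ (1 / 2 - ((i - j : ℕ) : ℝ))) =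
        C ^ 2 * a * b * ‖x‖ ^ (1 - (i : ℝ)) := by
      have : ‖x‖ ^ (1 - (i : ℝ)) =
          ‖x‖ ^ (1 / 2 - (j : ℝ)) * ‖x‖ ^ (1 / 2 - ((i - j : ℕ) : ℝ)) := by
        rw [← Real.rpow_add hxp]; congr 1; push_cast [Nat.cast_sub hji.le]; ring
      rw [this]; ring
    have q5 : ‖x‖ ^ (1 - (i : ℝ)) ≤ ‖x‖ ^ (1 - (m : ℝ)) := by
      apply Real.rpow_le_rpow_of_exponent_ge hxp hx1.le
      have : (i : ℝ) ≤ m := by exact_mod_cast him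
      linarith
    have q6 : C ^ 2 * a * b * ‖x‖ ^ (1 - (i : ℝ)) ≤ D * a * b * ‖x‖ ^ (1 - (m : ℝ)) := by
      gcongr
    linarith
  refine hL.trans ((Finset.sum_le_sum hterm).trans ?_)
  rw [← Finset.sum_mul]
  have hch : (∑ j ∈ Finset.range (i + 1), (i.choose j : ℝ)) ≤ 2 ^ m := by
    have : (∑ j ∈ Finset.range (i + 1), (i.choose j : ℝ)) = 2 ^ i := by
      exact_mod_cast Nat.sum_range_choose i
    rw [this]; exact pow_le_pow_right₀ (by norm_num) him
  have h0 := add_nonneg (add_nonneg p1 p2) p3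
  refine (mul_le_mul_of_nonneg_right hch h0).trans_eq ?_
  generalize ‖iteratedFDeriv ℝ i f x‖ = r, ‖iteratedFDeriv ℝ i g x‖ = s,
    ‖x‖ ^ (1 - (m : ℝ)) = t
  ring

theorem exists_smoothNorm_mul_le (hm : 2 ≤ m) (hn : n + 1 = 2 * m) : ∃ K : ℝ, 0 < K ∧
    ∀ f g : E n → ℂ, IsSmoothRadial f → IsSmoothRadial g →
      smoothNorm m (f * g) ≤ K * smoothNorm m f * smoothNorm m g := by
  obtain ⟨C, hC, hpt⟩ := exists_leibniz_bound hm hn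
  have : Nonempty (Fin n) := ⟨⟨0, by omega⟩⟩
  have hW := memLp_norm_rpow_ball hm hn
  set W : ℝ := (eLpNorm (fun x : E n => ‖x‖ ^ (1 - (m : ℝ))) 2 (ballMeasure n)).toReal with hWdef
  have hW0 : 0 ≤ W := ENNReal.toReal_nonneg
  -- The 2 counts the end terms of the Leibniz rule, `W` the singular weight, and m + 1 the orders
  -- of differentiation.
  refine ⟨(m + 1) * (C * (2 + W)), by positivity, fun f g hf hg => ?_⟩
  have key : ∀ i ∈ Finset.range (m + 1), derivNorm i (f * g) ≤
      C * (2 + W) * smoothNorm m f * smoothNorm m g := by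
    intro i hi
    have him : i ≤ m := by simpa [Nat.lt_succ_iff] using hi
    have ha := smoothNorm_nonneg m f
    have hb := smoothNorm_nonneg m g
    have hG1 := (hg.memLp_iteratedFDeriv i).norm.const_mul (C * smoothNorm m f)
    have hG2 := (hf.memLp_iteratedFDeriv i).norm.const_mul (C * smoothNorm m g)
    have hG3 := hW.const_mul (C * smoothNorm m f * smoothNorm m g)
    have h1 := toReal_eLpNorm_mono_ae (h := iteratedFDeriv ℝ i (f * g)) ((hG1.add hG2).add hG3) <| by
      filter_upwards [ae_ball_ne_zero] with x ⟨hx0, hx1⟩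
      exact (hpt f g hf hg i him x hx0 hx1).trans (Real.le_norm_self _)
    have h2 := toReal_eLpNorm_add_le (hG1.add hG2) hG3
    have h3 := toReal_eLpNorm_add_le hG1 hG2
    rw [toReal_eLpNorm_const_mul (by positivity), ← hWdef] at h2
    rw [toReal_eLpNorm_const_mul (by positivity), toReal_eLpNorm_const_mul (by positivity),
      eLpNorm_norm, eLpNorm_norm] at h3
    have r1 : derivNorm i g ≤ smoothNorm m g := derivNorm_le_smoothNorm him g
    have r2 : derivNorm i f ≤ smoothNorm m f := derivNorm_le_smoothNorm him f
    have s1 := mul_le_mul_of_nonneg_left r1 (mul_nonneg hC.le ha)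
    have s2 := mul_le_mul_of_nonneg_left r2 (mul_nonneg hC.le hb)
    rw [derivNorm] at s1 s2 ⊢
    linarith
  refine (Finset.sum_le_sum key).trans (le_of_eq ?_)
  simp only [Finset.sum_const, Finset.card_range, nsmul_eq_mul]
  push_cast
  ring

end WaveMaps
end

noncomputable section
namespace WaveMaps

/-! ### Integration by parts -/

variable {n m : ℕ} {f g : E n → ℂ}

theorem fderiv_iteratedFDeriv_apply {F : Type*} [NormedAddCommGroup F] [NormedSpace ℝ F]
    {h : E n → F} (hh : ContDiff ℝ ∞ h) {k : ℕ} (v : Fin k → E n) (e x : E n) :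
    fderiv ℝ (fun y => iteratedFDeriv ℝ k h y v) x e =
      iteratedFDeriv ℝ (k + 1) h x (Fin.cons e v) := by
  have hd : DifferentiableAt ℝ (iteratedFDeriv ℝ k h) x :=
    hh.differentiable_iteratedFDeriv (by exact_mod_cast ENat.natCast_lt_top k) x
  rw [hd.iteratedFDeriv_succ_apply_left']
  simp

theorem contDiff_iteratedFDeriv_apply {F : Type*} [NormedAddCommGroup F] [NormedSpace ℝ F]
    {h : E n → F} (hh : ContDiff ℝ ∞ h) {k : ℕ} (v : Fin k → E n) :
    ContDiff ℝ ∞ (fun y => iteratedFDeriv ℝ k h y v) := by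
  have h1 : ContDiff ℝ ∞ (iteratedFDeriv ℝ k h) :=
    hh.iteratedFDeriv_right (by exact_mod_cast le_top)
  exact (ContinuousMultilinearMap.apply ℝ (fun _ : Fin k => E n) F v).contDiff.comp h1

theorem hasCompactSupport_iteratedFDeriv_apply {φ : E n → ℝ} (hc : HasCompactSupport φ) {k : ℕ}
    (v : Fin k → E n) : HasCompactSupport (fun y => iteratedFDeriv ℝ k φ y v) :=
  (hc.iteratedFDeriv k).comp_left (g := fun (L : (E n) [×k]→L[ℝ] ℝ) => L v) (by simp)

theorem integral_iteratedFDeriv_smul_succ {φ : E n → ℝ} (hφ : ContDiff ℝ ∞ φ)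
    (hc : HasCompactSupport φ) (hf : ContDiff ℝ ∞ f) {k j : ℕ} (w : Fin (k + 1) → E n)
    (v : Fin j → E n) :
    ∫ x, iteratedFDeriv ℝ (k + 1) φ x w • iteratedFDeriv ℝ j f x v =
      -∫ x, iteratedFDeriv ℝ k φ x (Fin.tail w) •
        iteratedFDeriv ℝ (j + 1) f x (Fin.cons (w 0) v) := by
  set p : E n → ℝ := fun y => iteratedFDeriv ℝ k φ y (Fin.tail w) with hp
  set q : E n → ℂ := fun y => iteratedFDeriv ℝ j f y v with hq
  have hpc : HasCompactSupport p := hasCompactSupport_iteratedFDeriv_apply hc _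
  have hps : ContDiff ℝ ∞ p := contDiff_iteratedFDeriv_apply hφ _
  have hqs : ContDiff ℝ ∞ q := contDiff_iteratedFDeriv_apply hf _
  have h1 : ∀ x, fderiv ℝ p x (w 0) = iteratedFDeriv ℝ (k + 1) φ x w := fun x => by
    rw [fderiv_iteratedFDeriv_apply hφ, Fin.cons_self_tail]
  have h2 : ∀ x, fderiv ℝ q x (w 0) = iteratedFDeriv ℝ (j + 1) f x (Fin.cons (w 0) v) :=
    fun x => fderiv_iteratedFDeriv_apply hf _ _ _
  have c1 : Continuous fun x => fderiv ℝ p x (w 0) :=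
    (hps.continuous_fderiv (by simp)).clm_apply continuous_const
  have c2 : Continuous fun x => fderiv ℝ q x (w 0) :=
    (hqs.continuous_fderiv (by simp)).clm_apply continuous_const
  have c3 : HasCompactSupport fun x => fderiv ℝ p x (w 0) :=
    (hpc.fderiv ℝ).comp_left (g := fun (L : E n →L[ℝ] ℝ) => L (w 0)) (by simp)
  have := integral_bilinear_fderiv_right_eq_neg_left_of_integrable (μ := volume) (f := p) (g := q)
    (v := w 0) (B := ContinuousLinearMap.lsmul ℝ ℝ)
    ((c1.smul hqs.continuous).integrable_of_hasCompactSupport c3.smul_right)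
    ((hps.continuous.smul c2).integrable_of_hasCompactSupport hpc.smul_right)
    ((hps.continuous.smul hqs.continuous).integrable_of_hasCompactSupport hpc.smul_right)
    (fun x _ => (hps.differentiable (by simp)) x)
    (fun x _ => (hqs.differentiable (by simp)) x)
  simp only [ContinuousLinearMap.lsmul_apply, h1, h2] at this
  rw [this, neg_neg]

/-- Derivatives move from φ to f one at a time. The resulting directions are not identified, since
only their norms matter later, so no symmetry of derivatives is needed. They are chosen before φ and
f, hence serve a whole sequence of functions. The equation for `l` avoids transport between `Fin`
types. -/
theorem exists_integral_iteratedFDeriv_smul (k : ℕ) : ∀ (j : ℕ) (w : Fin k → E n)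
    (v : Fin j → E n), (∀ i, ‖w i‖ ≤ 1) → (∀ i, ‖v i‖ ≤ 1) →
    ∃ (l : ℕ) (v' : Fin l → E n), l = j + k ∧ (∀ i, ‖v' i‖ ≤ 1) ∧
      ∀ (φ : E n → ℝ) (f : E n → ℂ), ContDiff ℝ ∞ φ → HasCompactSupport φ → ContDiff ℝ ∞ f →
        ∫ x, iteratedFDeriv ℝ k φ x w • iteratedFDeriv ℝ j f x v =
          (-1 : ℝ) ^ k • ∫ x, φ x • iteratedFDeriv ℝ l f x v' := by
  induction k with
  | zero =>
    intro j w v _ hv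
    exact ⟨j, v, rfl, hv, fun φ f _ _ _ => by simp⟩
  | succ k ih =>
    intro j w v hw hv
    obtain ⟨l, v', hl, hv', h⟩ := ih (j + 1) (Fin.tail w) (Fin.cons (w 0) v) (fun i => hw _)
      (fun i => by refine Fin.cases (by simpa using hw 0) (fun i => by simpa using hv i) i)
    refine ⟨l, v', by omega, hv', fun φ f hφ hc hf => ?_⟩
    rw [integral_iteratedFDeriv_smul_succ hφ hc hf, h φ f hφ hc hf, pow_succ, mul_neg_one, neg_smul]

theorem exists_integral_partialDeriv_smul {k : ℕ} (w : Fin k → Fin n) :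
    ∃ v : Fin k → E n, (∀ i, ‖v i‖ ≤ 1) ∧
      ∀ (φ : E n → ℝ) (f : E n → ℂ), ContDiff ℝ ∞ φ → HasCompactSupport φ →
        tsupport φ ⊆ unitBall n → ContDiff ℝ ∞ f →
        ∫ x in unitBall n, partialDeriv w φ x • f x =
          (-1 : ℝ) ^ k • ∫ x in unitBall n, φ x • iteratedFDeriv ℝ k f x v := by
  obtain ⟨l, v, hl, hv, h⟩ := exists_integral_iteratedFDeriv_smul k 0
    (fun j => EuclideanSpace.single (w j) (1 : ℝ)) (Fin.elim0 : Fin 0 → E n) (by simp)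
    (fun i => i.elim0)
  obtain rfl : l = k := by omega
  refine ⟨v, hv, fun φ f hφ hc hs hf => ?_⟩
  rw [setIntegral_eq_integral_of_forall_compl_eq_zero,
    setIntegral_eq_integral_of_forall_compl_eq_zero]
  · simpa [partialDeriv] using h φ f hφ hc hf
  · intro x hx
    rw [image_eq_zero_of_notMem_tsupport (fun hx' => hx (hs hx')), zero_smul]
  · intro x hx
    have : x ∉ tsupport (iteratedFDeriv ℝ l φ) := fun hx' =>
      hx (hs (tsupport_iteratedFDeriv_subset l hx'))
    rw [partialDeriv, image_eq_zero_of_notMem_tsupport this]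
    simp

theorem norm_iteratedFDeriv_apply_le {F : Type*} [NormedAddCommGroup F] [NormedSpace ℝ F]
    {k : ℕ} (h : E n → F) (x : E n) {v : Fin k → E n} (hv : ∀ i, ‖v i‖ ≤ 1) :
    ‖iteratedFDeriv ℝ k h x v‖ ≤ ‖iteratedFDeriv ℝ k h x‖ := by
  refine (ContinuousMultilinearMap.le_opNorm _ _).trans ?_
  exact mul_le_of_le_one_right (norm_nonneg _) (Finset.prod_le_one (fun _ _ => norm_nonneg _)
    fun i _ => hv i)

/-! ### Weak limits of bounded sequences -/

/-- Banach–Alaoglu in the dual, along an ultrafilter instead of a subsequence, so that separability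
plays no role. -/
theorem exists_weak_limit {𝓚 : Type*} [NormedAddCommGroup 𝓚] [InnerProductSpace ℂ 𝓚]
    [CompleteSpace 𝓚] {M : ℝ} {x : ℕ → 𝓚} (hx : ∀ k, ‖x k‖ ≤ M) :
    ∃ (y : 𝓚) (𝓤 : Ultrafilter ℕ), ‖y‖ ≤ M ∧ (𝓤 : Filter ℕ) ≤ Filter.atTop ∧
      ∀ h : 𝓚, Filter.Tendsto (fun k => inner ℂ h (x k)) 𝓤 (nhds (inner ℂ h y)) := by
  set 𝓤 : Ultrafilter ℕ := Filter.hyperfilter ℕ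
  have hU : (𝓤 : Filter ℕ) ≤ Filter.atTop := by
    rw [← Nat.cofinite_eq_atTop]; exact Filter.hyperfilter_le_cofinite
  set L : ℕ → WeakDual ℂ 𝓚 := fun k =>
    StrongDual.toWeakDual (InnerProductSpace.toDual ℂ 𝓚 (x k)) with hL
  have hK := WeakDual.isCompact_closedBall (𝕜 := ℂ) (0 : StrongDual ℂ 𝓚) M
  have hmem : ∀ k, L k ∈ WeakDual.toStrongDual ⁻¹' Metric.closedBall (0 : StrongDual ℂ 𝓚) M := by
    intro k
    simpa [hL] using hx k
  obtain ⟨ℓ, hℓ, hlim⟩ := hK.ultrafilter_le_nhds (𝓤.map L)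
    (by
      rw [Filter.le_principal_iff]
      exact Filter.mem_map.2 (Filter.Eventually.of_forall hmem))
  refine ⟨(InnerProductSpace.toDual ℂ 𝓚).symm (WeakDual.toStrongDual ℓ), 𝓤, ?_, hU, fun h => ?_⟩
  · simpa using hℓ
  · have h1 : Filter.Tendsto (fun k => (L k) h) 𝓤 (nhds (ℓ h)) :=
      ((WeakDual.eval_continuous h).tendsto ℓ).comp hlim
    -- The limit was found with `x k` in the first, conjugate-linear slot; conjugation exchanges the
    -- slots.
    have h2 := (Complex.continuous_conj.tendsto _).comp h1
    have e1 : (starRingEnd ℂ) (ℓ h) =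
        inner ℂ h ((InnerProductSpace.toDual ℂ 𝓚).symm (WeakDual.toStrongDual ℓ)) := by
      rw [← inner_conj_symm, InnerProductSpace.toDual_symm_apply]
      rfl
    rw [← e1]
    refine h2.congr fun k => ?_
    change (starRingEnd ℂ) (inner ℂ (x k) h) = _
    rw [inner_conj_symm]

theorem exists_weak_limit_memLp {α : Type*} [MeasurableSpace α] {μ : Measure α} {M : ℝ}
    {G : ℕ → α → ℂ} (hG : ∀ k, MemLp (G k) 2 μ) (hM : ∀ k, (eLpNorm (G k) 2 μ).toReal ≤ M) :
    ∃ (g : α → ℂ) (𝓤 : Ultrafilter ℕ), MemLp g 2 μ ∧ (eLpNorm g 2 μ).toReal ≤ M ∧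
      (𝓤 : Filter ℕ) ≤ Filter.atTop ∧ ∀ φ : α → ℝ, MemLp φ 2 μ →
        Filter.Tendsto (fun k => ∫ x, φ x • G k x ∂μ) 𝓤 (nhds (∫ x, φ x • g x ∂μ)) := by
  obtain ⟨y, 𝓤, hy, hU, h⟩ := exists_weak_limit (x := fun k => (hG k).toLp (G k)) (M := M)
    (fun k => by rw [Lp.norm_toLp]; exact hM k)
  refine ⟨y, 𝓤, Lp.memLp y, by simpa [Lp.norm_def] using hy, hU, fun φ hφ => ?_⟩
  have hφc : MemLp (fun x => (φ x : ℂ)) 2 μ := hφ.ofReal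
  have h1 := h (hφc.toLp _)
  simp only [L2.inner_def] at h1
  have e1 : ∀ {u v : α → ℂ}, u =ᵐ[μ] v → ∫ x, inner ℂ ((hφc.toLp _ : α → ℂ) x) (u x) ∂μ =
      ∫ x, φ x • v x ∂μ := by
    intro u v huv
    refine integral_congr_ae ?_
    filter_upwards [huv, hφc.coeFn_toLp] with x h1 h2
    rw [h2, h1]
    simp [mul_comm]
  rw [e1 (v := y) (Filter.EventuallyEq.refl _ _)] at h1
  exact h1.congr fun k => e1 (hG k).coeFn_toLp

/-! ### Limits of bounded sequences of smooth functions -/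

theorem sobolevNorm_le {M : ℝ} (hM : 0 ≤ M)
    (h : ∀ k ≤ m, ∀ w : Fin k → Fin n, (eLpNorm (weakDeriv w f) 2 (ballMeasure n)).toReal ≤ M) :
    sobolevNorm m f ≤
      Real.sqrt (∑ k ∈ Finset.range (m + 1), (Fintype.card (Fin k → Fin n) : ℝ)) * M := by
  rw [sobolevNorm]
  have : ∑ k ∈ Finset.range (m + 1), ∑ w : Fin k → Fin n,
      (eLpNorm (weakDeriv w f) 2 (ballMeasure n)).toReal ^ 2 ≤
      (∑ k ∈ Finset.range (m + 1), (Fintype.card (Fin k → Fin n) : ℝ)) * M ^ 2 := by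
    rw [Finset.sum_mul]
    refine Finset.sum_le_sum fun k hk => ?_
    refine (Finset.sum_le_card_nsmul _ _ (M ^ 2) fun w _ => ?_).trans_eq (by simp)
    exact pow_le_pow_left₀ ENNReal.toReal_nonneg
      (h k (by simpa [Nat.lt_succ_iff] using hk) w) 2
  refine (Real.sqrt_le_sqrt this).trans_eq ?_
  rw [Real.sqrt_mul (Finset.sum_nonneg fun _ _ => Nat.cast_nonneg _), Real.sqrt_sq hM]

theorem weakDeriv_ae_eq {k : ℕ} {w : Fin k → Fin n} (hg : MemLp g 2 (ballMeasure n))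
    (hfg : IsWeakDeriv w f g) : weakDeriv w f =ᵐ[ballMeasure n] g := by
  have h : ∃ g : E n → ℂ, MemLp g 2 (ballMeasure n) ∧ IsWeakDeriv w f g := ⟨g, hg, hfg⟩
  rw [weakDeriv, dif_pos h]
  exact IsWeakDeriv.ae_eq h.choose_spec.1 hg h.choose_spec.2 hfg

/-- An almost everywhere limit of smooth radial functions that are bounded in the Sobolev norm
belongs to the Sobolev space. -/
theorem exists_sobolevNorm_le_of_tendsto (hm : 2 ≤ m) (hn : n + 1 = 2 * m) :
    ∃ C : ℝ, 0 < C ∧ ∀ (f : E n → ℂ) (F : ℕ → E n → ℂ) (M : ℝ),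
      (∀ k, IsSmoothRadial (F k)) → (∀ k, smoothNorm m (F k) ≤ M) →
      (∀ᵐ x ∂(ballMeasure n), Filter.Tendsto (fun k => F k x) Filter.atTop (nhds (f x))) →
      ∀ m' ≤ m, MemSobolev m' f ∧ sobolevNorm m' f ≤ C * M := by
  obtain ⟨C, hC, hpt⟩ := exists_pointwise_bound hm hn
  have : Nonempty (Fin n) := ⟨⟨0, by omega⟩⟩
  -- Summing the constants over all m' ≤ m gives one that serves every order.
  refine ⟨∑ m' ∈ Finset.range (m + 1), (Real.sqrt (∑ k ∈ Finset.range (m' + 1),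
    (Fintype.card (Fin k → Fin n) : ℝ)) + 1), Finset.sum_pos (fun _ _ => by positivity) (by simp),
    fun f F M hF hM hlim m' hm' => ?_⟩
  have hM0 : 0 ≤ M := (smoothNorm_nonneg _ _).trans (hM 0)
  -- The embedding into bounded functions makes the almost everywhere convergence dominated.
  have hbd : ∀ k, ∀ᵐ x ∂(ballMeasure n), ‖F k x‖ ≤ C * M := by
    intro k
    filter_upwards [ae_ball_ne_zero] with x ⟨hx0, hx1⟩
    exact (hpt _ (hF k) x hx0 hx1.le).2.trans (by gcongr; exact hM k)
  have hmeas : ∀ k, AEStronglyMeasurable (F k) (ballMeasure n) := fun k =>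
    (hF k).1.continuous.aestronglyMeasurable
  have hfm : AEStronglyMeasurable f (ballMeasure n) :=
    aestronglyMeasurable_of_tendsto_ae Filter.atTop hmeas hlim
  have hfL : MemLp f 2 (ballMeasure n) := by
    refine MemLp.of_bound hfm (C * M) ?_
    filter_upwards [hlim, ae_all_iff.2 hbd] with x h1 h2
    exact le_of_tendsto h1.norm (Filter.Eventually.of_forall h2)
  have hweak : ∀ k ≤ m, ∀ w : Fin k → Fin n, ∃ g : E n → ℂ, MemLp g 2 (ballMeasure n) ∧
      (eLpNorm g 2 (ballMeasure n)).toReal ≤ M ∧ IsWeakDeriv w f g := by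
    intro k hk w
    obtain ⟨v, hv, hibp⟩ := exists_integral_partialDeriv_smul w
    have hG : ∀ i, MemLp (fun x => iteratedFDeriv ℝ k (F i) x v) 2 (ballMeasure n) := fun i =>
      memLp_ball_of_continuous (contDiff_iteratedFDeriv_apply (hF i).1 v).continuous
    obtain ⟨g, 𝓤, hg, hgM, hU, hconv⟩ := exists_weak_limit_memLp hG (M := M) (fun i =>
      (toReal_eLpNorm_mono_ae ((hF i).memLp_iteratedFDeriv k) (Filter.Eventually.of_forall fun x =>
        norm_iteratedFDeriv_apply_le _ x hv)).trans
        ((derivNorm_le_smoothNorm hk (F i)).trans (hM i)))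
    refine ⟨g, hg, hgM, fun φ hφ hc hs => ?_⟩
    have hpc : Continuous (partialDeriv w φ) := (contDiff_iteratedFDeriv_apply hφ _).continuous
    obtain ⟨B, hB⟩ := (hasCompactSupport_iteratedFDeriv_apply hc
      (fun j => EuclideanSpace.single (w j) (1 : ℝ))).exists_bound_of_continuous hpc
    have hl1 : Filter.Tendsto (fun i => ∫ x in unitBall n, partialDeriv w φ x • F i x)
        Filter.atTop (nhds (∫ x in unitBall n, partialDeriv w φ x • f x)) := by
      refine tendsto_integral_of_dominated_convergence (fun _ => B * (C * M))
        (fun i => hpc.aestronglyMeasurable.smul (hmeas i)) (integrable_const _) (fun i => ?_) ?_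
      · filter_upwards [hbd i] with x hx
        rw [norm_smul]
        exact mul_le_mul (hB x) hx (norm_nonneg _) ((norm_nonneg _).trans (hB x))
      · filter_upwards [hlim] with x hx
        exact hx.const_smul _
    have hl2 := (hconv φ (memLp_ball_of_continuous hφ.continuous)).const_smul ((-1 : ℝ) ^ k)
    -- Integration by parts holds for each `F i`; the left side converges by dominated convergence,
    -- the right side by weak convergence tested against φ.
    refine tendsto_nhds_unique (hl1.mono_left hU) (hl2.congr fun i => ?_)
    exact (hibp φ (F i) hφ hc hs (hF i).1).symm
  refine ⟨⟨hfL, fun k hk w => ?_⟩, ?_⟩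
  · obtain ⟨g, hg, -, h⟩ := hweak k (hk.trans hm') w
    exact ⟨g, hg, h⟩
  · refine (sobolevNorm_le hM0 fun k hk w => ?_).trans ?_
    · obtain ⟨g, hg, hgM, h⟩ := hweak k (hk.trans hm') w
      rwa [eLpNorm_congr_ae (weakDeriv_ae_eq hg h)]
    · gcongr
      refine le_trans ?_ (Finset.single_le_sum (f := fun m' => Real.sqrt
        (∑ k ∈ Finset.range (m' + 1), (Fintype.card (Fin k → Fin n) : ℝ)) + 1)
        (fun _ _ => by positivity) (Finset.mem_range.2 (Nat.lt_succ_of_le hm')))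
      simp

end WaveMaps
end

noncomputable section
namespace WaveMaps

/-! ### Convolution with a dilated argument -/

variable {n m : ℕ} {f g u v : E n → ℂ}

/-- The function `x ↦ ∫ Φ (r x - y) u(y) dy`, the integral being over the unit ball. -/
def ballConv (Φ : E n → ℝ) (r : ℝ) (u : E n → ℂ) (x : E n) : ℂ :=
  ∫ y in unitBall n, Φ (r • x - y) • u y

theorem ballConv_eq_convolution (Φ : E n → ℝ) (r : ℝ) (u : E n → ℂ) :
    ballConv Φ r u = fun x => convolution Φ ((unitBall n).indicator u)
      (ContinuousLinearMap.lsmul ℝ ℝ) volume (r • x) := by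
  ext x
  rw [convolution_eq_swap, ballConv, ← integral_indicator measurableSet_ball]
  congr 1; ext y
  by_cases hy : y ∈ unitBall n
  · simp [Set.indicator_of_mem hy]
  · simp [Set.indicator_of_notMem hy]

theorem contDiff_ballConv {Φ : E n → ℝ} (hΦ : ContDiff ℝ ∞ Φ) (hc : HasCompactSupport Φ) (r : ℝ)
    (hu : IntegrableOn u (unitBall n)) : ContDiff ℝ ∞ (ballConv Φ r u) := by
  rw [ballConv_eq_convolution]
  have h := hc.contDiff_convolution_left (μ := volume) (ContinuousLinearMap.lsmul ℝ ℝ) hΦ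
    (hu.integrable_indicator measurableSet_ball).locallyIntegrable
  exact h.comp (contDiff_const_smul r)

theorem fderiv_ballConv_apply {Φ : E n → ℝ} (hΦ : ContDiff ℝ ∞ Φ) (hc : HasCompactSupport Φ)
    (r : ℝ) (hu : IntegrableOn u (unitBall n)) (x e : E n) :
    fderiv ℝ (ballConv Φ r u) x e = r • ballConv (fun z => fderiv ℝ Φ z e) r u x := by
  have hli := (hu.integrable_indicator measurableSet_ball).locallyIntegrable
  have h := (hc.hasFDerivAt_convolution_left (μ := volume) (ContinuousLinearMap.lsmul ℝ ℝ)
    (hΦ.of_le (by exact_mod_cast le_top)) hli (r • x))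
  have h2 : HasFDerivAt (fun x : E n => r • x) (r • ContinuousLinearMap.id ℝ (E n)) x :=
    (hasFDerivAt_id x).const_smul r
  have h3 := h.comp x h2
  have hex := (hc.fderiv ℝ).convolutionExists_left
    (ContinuousLinearMap.precompL (E n) (ContinuousLinearMap.lsmul ℝ ℝ))
    (hΦ.continuous_fderiv (by simp)) hli (r • x)
  have h4 : ballConv (fun z => fderiv ℝ Φ z e) r u x =
      (convolution (fderiv ℝ Φ) ((unitBall n).indicator u)
        (ContinuousLinearMap.precompL (E n) (ContinuousLinearMap.lsmul ℝ ℝ)) volume (r • x)) e := by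
    rw [ballConv_eq_convolution]
    exact (ContinuousLinearMap.integral_apply hex e).symm
  rw [h4, ballConv_eq_convolution]
  change fderiv ℝ ((convolution Φ ((unitBall n).indicator u) (ContinuousLinearMap.lsmul ℝ ℝ)
    volume) ∘ fun x => r • x) x e = _
  rw [h3.fderiv]
  simp

theorem iteratedFDeriv_ballConv_apply {Φ : E n → ℝ} (hΦ : ContDiff ℝ ∞ Φ)
    (hc : HasCompactSupport Φ) (r : ℝ) (hu : IntegrableOn u (unitBall n)) {k : ℕ}
    (w : Fin k → E n) (x : E n) :
    iteratedFDeriv ℝ k (ballConv Φ r u) x w =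
      r ^ k • ballConv (fun z => iteratedFDeriv ℝ k Φ z w) r u x := by
  induction k generalizing x with
  | zero => simp [ballConv]
  | succ k ih =>
    rw [← Fin.cons_self_tail w, ← fderiv_iteratedFDeriv_apply (contDiff_ballConv hΦ hc r hu)]
    simp only [ih]
    have hs := contDiff_iteratedFDeriv_apply hΦ (Fin.tail w)
    have hcs := hasCompactSupport_iteratedFDeriv_apply hc (Fin.tail w)
    have hd := ((contDiff_ballConv hs hcs r hu).differentiable (by simp)) x
    rw [fderiv_fun_const_smul hd, smul_apply, fderiv_ballConv_apply hs hcs r hu,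
      smul_smul, pow_succ]
    simp only [fderiv_iteratedFDeriv_apply hΦ]

theorem ballConv_comp_isometry {Φ : E n → ℝ} (hΦ : ∀ R : E n ≃ₗᵢ[ℝ] E n, Φ ∘ R = Φ)
    (hu : ∀ R : E n ≃ₗᵢ[ℝ] E n, u ∘ R = u) (r : ℝ) (R : E n ≃ₗᵢ[ℝ] E n) :
    ballConv Φ r u ∘ R = ballConv Φ r u := by
  ext x
  have h1 := R.measurePreserving.setIntegral_preimage_emb
    R.toHomeomorph.measurableEmbedding (fun y => Φ (r • R x - y) • u y) (unitBall n)
  have h2 : R ⁻¹' unitBall n = unitBall n := by ext y; simp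
  rw [h2] at h1
  simp only [Function.comp_apply, ballConv]
  rw [← h1]
  congr 1; ext y
  rw [← map_smul, ← map_sub, show Φ (R (r • x - y)) = Φ (r • x - y) from congrFun (hΦ R) _,
    show u (R y) = u y from congrFun (hu R) _]

theorem integrableOn_smul_of_continuous {Φ : E n → ℝ} (hΦ : Continuous Φ)
    (hc : HasCompactSupport Φ) (z : E n) (hu : IntegrableOn u (unitBall n)) :
    IntegrableOn (fun y => Φ (z - y) • u y) (unitBall n) := by
  obtain ⟨C, hC⟩ := hc.exists_bound_of_continuous hΦ
  exact hu.bdd_smul C (by fun_prop : Continuous fun y => Φ (z - y)).aestronglyMeasurable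
    (Filter.Eventually.of_forall fun y => hC _)

theorem ballConv_sub {Φ : E n → ℝ} (hΦ : Continuous Φ)
    (hc : HasCompactSupport Φ) (r : ℝ) (hu : IntegrableOn u (unitBall n))
    (hv : IntegrableOn v (unitBall n)) :
    ballConv Φ r (u - v) = ballConv Φ r u - ballConv Φ r v := by
  ext x
  simp only [ballConv, Pi.sub_apply, smul_sub]
  exact integral_sub (integrableOn_smul_of_continuous hΦ hc _ hu)
    (integrableOn_smul_of_continuous hΦ hc _ hv)

/-! ### The mollifier -/

/-- A smooth radial bump function supported in the closed unit ball. -/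
def bump (n : ℕ) (z : E n) : ℝ := expNegInvGlue (1 - ‖z‖ ^ 2)

theorem bump_nonneg (z : E n) : 0 ≤ bump n z := expNegInvGlue.nonneg _

theorem bump_le_one (z : E n) : bump n z ≤ 1 := by
  rw [bump, expNegInvGlue]
  split_ifs with h
  · exact zero_le_one
  · rw [Real.exp_le_one_iff]
    push Not at h
    simpa using h.le

theorem contDiff_bump : ContDiff ℝ ∞ (bump n) :=
  expNegInvGlue.contDiff.comp (contDiff_const.sub (contDiff_norm_sq ℝ))

theorem bump_eq_zero {z : E n} (hz : 1 ≤ ‖z‖) : bump n z = 0 :=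
  expNegInvGlue.zero_of_nonpos (by nlinarith)

theorem bump_pos {z : E n} (hz : ‖z‖ < 1) : 0 < bump n z :=
  expNegInvGlue.pos_of_pos (by nlinarith [norm_nonneg z])

theorem hasCompactSupport_bump : HasCompactSupport (bump n) :=
  HasCompactSupport.intro (isCompact_closedBall (0 : E n) 1) fun z hz =>
    bump_eq_zero (by simpa using (not_le.1 (by simpa using hz) : 1 < ‖z‖).le)

theorem integral_bump_pos : 0 < ∫ z : E n, bump n z :=
  contDiff_bump.continuous.integral_pos_of_hasCompactSupport_nonneg_nonzero
    hasCompactSupport_bump bump_nonneg (x := 0) (bump_pos (by simp)).ne'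

/-- The bump function rescaled to radius `ε` and normalized to have integral one. -/
def mollifier (n : ℕ) (ε : ℝ) (z : E n) : ℝ :=
  (ε ^ n * ∫ z : E n, bump n z)⁻¹ * bump n (ε⁻¹ • z)

variable {ε : ℝ}

theorem mollifier_nonneg (hε : 0 < ε) (z : E n) : 0 ≤ mollifier n ε z := by
  have := integral_bump_pos (n := n)
  exact mul_nonneg (by positivity) (bump_nonneg _)

theorem mollifier_le (hε : 0 < ε) (z : E n) :
    mollifier n ε z ≤ (ε ^ n * ∫ z : E n, bump n z)⁻¹ := by
  have := integral_bump_pos (n := n)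
  exact mul_le_of_le_one_right (by positivity) (bump_le_one _)

theorem contDiff_mollifier (ε : ℝ) : ContDiff ℝ ∞ (mollifier n ε) :=
  contDiff_const.mul (contDiff_bump.comp (contDiff_const_smul _))

theorem mollifier_eq_zero (hε : 0 < ε) {z : E n} (hz : ε ≤ ‖z‖) : mollifier n ε z = 0 := by
  rw [mollifier, bump_eq_zero, mul_zero]
  rw [norm_smul, norm_inv, Real.norm_of_nonneg hε.le, inv_mul_eq_div, le_div_iff₀ hε]
  linarith

theorem hasCompactSupport_mollifier (hε : 0 < ε) : HasCompactSupport (mollifier n ε) :=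
  HasCompactSupport.intro (isCompact_closedBall (0 : E n) ε) fun z hz =>
    mollifier_eq_zero hε (by simpa using (not_le.1 (by simpa using hz) : ε < ‖z‖).le)

theorem mollifier_comp_isometry (R : E n ≃ₗᵢ[ℝ] E n) : mollifier n ε ∘ R = mollifier n ε := by
  ext z; simp [mollifier, bump, norm_smul]

theorem integral_mollifier (hε : 0 < ε) : ∫ z : E n, mollifier n ε z = 1 := by
  have h1 := integral_bump_pos (n := n)
  simp only [mollifier]
  rw [integral_const_mul, Measure.integral_comp_inv_smul volume (bump n) ε]
  simp only [finrank_euclideanSpace_fin, smul_eq_mul, abs_of_pos (pow_pos hε n)]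
  exact inv_mul_cancel₀ (by positivity)

theorem integrable_mollifier (hε : 0 < ε) : Integrable (mollifier n ε) :=
  (contDiff_mollifier ε).continuous.integrable_of_hasCompactSupport (hasCompactSupport_mollifier hε)

/-- Smooth approximation of a function on the unit ball by contraction and mollification. -/
def mollify (ε : ℝ) (u : E n → ℂ) : E n → ℂ := ballConv (mollifier n ε) (1 - ε) u

theorem isSmoothRadial_mollify (hε : 0 < ε) (hu : IntegrableOn u (unitBall n))
    (hR : ∀ R : E n ≃ₗᵢ[ℝ] E n, u ∘ R = u) : IsSmoothRadial (mollify ε u) :=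
  ⟨contDiff_ballConv (contDiff_mollifier ε) (hasCompactSupport_mollifier hε) _ hu,
    ballConv_comp_isometry mollifier_comp_isometry hR _⟩

theorem mollify_sub (hε : 0 < ε) (hu : IntegrableOn u (unitBall n))
    (hv : IntegrableOn v (unitBall n)) : mollify ε (u - v) = mollify ε u - mollify ε v :=
  ballConv_sub (contDiff_mollifier ε).continuous (hasCompactSupport_mollifier hε) _ hu hv

theorem partialDeriv_comp_const_sub {φ : E n → ℝ} (hφ : ContDiff ℝ ∞ φ) {k : ℕ}
    (w : Fin k → Fin n) (z y : E n) :
    partialDeriv w (fun y => φ (z - y)) y = (-1) ^ k * partialDeriv w φ (z - y) := by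
  have h2 : (fun y => φ (z - y)) = fun y => (fun t => φ (z + t)) ((-1 : ℝ) • y) := by
    ext y; simp [sub_eq_add_neg]
  have h1 : ContDiff ℝ (k : ℕ) (fun t => φ (z + t)) :=
    (hφ.comp (contDiff_const.add contDiff_id)).of_le (by exact_mod_cast le_top)
  rw [partialDeriv, h2, iteratedFDeriv_comp_const_smul (-1) h1, partialDeriv]
  simp only [iteratedFDeriv_comp_add_left]
  simp [sub_eq_add_neg]

/-- The contraction keeps the ball of radius ε about (1 − ε)x inside the open unit ball for every x
there, so the translated and reflected mollifier is an admissible test function. The sign from the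
reflection y ↦ z − y cancels the one in the definition of the weak derivative. -/
theorem mollify_weakDeriv (hε : 0 < ε) (hε1 : ε < 1) (hu : IntegrableOn u (unitBall n)) {k : ℕ}
    {w : Fin k → Fin n} (hg : IsWeakDeriv w u g) {x : E n} (hx : ‖x‖ < 1) :
    iteratedFDeriv ℝ k (mollify ε u) x (fun j => EuclideanSpace.single (w j) (1 : ℝ)) =
      (1 - ε) ^ k • mollify ε g x := by
  rw [mollify, iteratedFDeriv_ballConv_apply (contDiff_mollifier ε) (hasCompactSupport_mollifier hε)
    _ hu]
  congr 1
  set z := (1 - ε) • x with hz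
  have hzn : ‖z‖ + ε < 1 := by
    rw [hz, norm_smul, Real.norm_of_nonneg (by linarith)]; nlinarith
  have hsupp : ∀ y, y ∉ Metric.closedBall z ε → mollifier n ε (z - y) = 0 := fun y hy =>
    mollifier_eq_zero hε (by
      rw [Metric.mem_closedBall, dist_comm, dist_eq_norm, not_le] at hy
      exact hy.le)
  have hts : tsupport (fun y => mollifier n ε (z - y)) ⊆ unitBall n := by
    refine (closure_minimal (fun y hy => ?_) Metric.isClosed_closedBall).trans
      (Metric.closedBall_subset_ball' (x := z) (ε₁ := ε) (by simpa [add_comm] using hzn))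
    by_contra h
    exact hy (hsupp y h)
  have h := hg (fun y => mollifier n ε (z - y))
    ((contDiff_mollifier ε).comp (contDiff_const.sub contDiff_id))
    (HasCompactSupport.intro (isCompact_closedBall z ε) hsupp) hts
  simp only [partialDeriv_comp_const_sub (contDiff_mollifier ε)] at h
  simp only [mul_smul] at h
  rw [integral_smul] at h
  exact smul_right_injective ℂ (pow_ne_zero k (by norm_num : (-1 : ℝ) ≠ 0)) h

/-! ### Norm bounds for the mollification -/

/-- Undoing the contraction costs the Jacobian (1 − ε)^(-n), at most 2^n for ε ≤ 1/2. -/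
theorem lintegral_mollifier_comp_le (hε : 0 < ε) (hε1 : ε ≤ 1 / 2) (y : E n) :
    ∫⁻ x in unitBall n, ENNReal.ofReal (mollifier n ε ((1 - ε) • x - y)) ≤
      ENNReal.ofReal (2 ^ n) := by
  have hr : 0 < 1 - ε := by linarith
  have h0 : Integrable (fun x : E n => mollifier n ε (x - y)) :=
    (integrable_mollifier hε).comp_sub_right y
  have hi : Integrable (fun x : E n => mollifier n ε ((1 - ε) • x - y)) :=
    h0.comp_smul hr.ne'
  refine (setLIntegral_le_lintegral _ _).trans ?_
  rw [← ofReal_integral_eq_lintegral_ofReal hi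
    (Filter.Eventually.of_forall fun x => mollifier_nonneg hε _)]
  refine ENNReal.ofReal_le_ofReal ?_
  rw [Measure.integral_comp_smul volume (fun x => mollifier n ε (x - y)) (1 - ε),
    integral_sub_right_eq_self (mollifier n ε) y, integral_mollifier hε,
    finrank_euclideanSpace_fin, smul_eq_mul, mul_one, abs_of_pos (by positivity), ← inv_pow]
  gcongr
  rw [inv_le_comm₀ hr (by norm_num)]
  linarith

theorem lintegral_mollifier_sub_le (hε : 0 < ε) (z : E n) :
    ∫⁻ y in unitBall n, ENNReal.ofReal (mollifier n ε (z - y)) ≤ 1 := by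
  refine (setLIntegral_le_lintegral _ _).trans ?_
  rw [← ofReal_integral_eq_lintegral_ofReal ((integrable_mollifier hε).comp_sub_left z)
    (Filter.Eventually.of_forall fun x => mollifier_nonneg hε _),
    integral_sub_left_eq_self (mollifier n ε) volume z, integral_mollifier hε, ENNReal.ofReal_one]

/-- Cauchy–Schwarz with the kernel split into two square roots; its total mass in y is at most one.
-/
theorem enorm_mollify_sq_le (hε : 0 < ε) (hg : MemLp g 2 (ballMeasure n)) (x : E n) :
    ‖mollify ε g x‖ₑ ^ 2 ≤ ∫⁻ y in unitBall n,
      ENNReal.ofReal (mollifier n ε ((1 - ε) • x - y)) * ‖g y‖ₑ ^ 2 := by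
  set z := (1 - ε) • x with hz
  set s : E n → ENNReal := fun y => ENNReal.ofReal (Real.sqrt (mollifier n ε (z - y))) with hs
  have hss : ∀ y, s y * s y = ENNReal.ofReal (mollifier n ε (z - y)) := fun y => by
    rw [hs]
    simp only
    rw [← ENNReal.ofReal_mul (Real.sqrt_nonneg _), Real.mul_self_sqrt (mollifier_nonneg hε _)]
  have hsm : AEMeasurable s (ballMeasure n) :=
    (ENNReal.continuous_ofReal.comp (Real.continuous_sqrt.comp
      ((contDiff_mollifier ε).continuous.comp (by fun_prop)))).aemeasurable
  have h1 : ‖mollify ε g x‖ₑ ≤ ∫⁻ y in unitBall n, (s * fun y => s y * ‖g y‖ₑ) y := by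
    refine (enorm_integral_le_lintegral_enorm _).trans_eq ?_
    congr 1; ext y
    rw [enorm_smul, Pi.mul_apply, ← mul_assoc, hss, Real.enorm_of_nonneg (mollifier_nonneg hε _)]
  have h2 := ENNReal.lintegral_mul_le_Lp_mul_Lq (ballMeasure n) Real.HolderConjugate.two_two
    hsm (hsm.mul hg.1.enorm)
  have h3 : ∫⁻ y in unitBall n, s y ^ (2 : ℝ) ≤ 1 := by
    refine le_trans (le_of_eq ?_) (lintegral_mollifier_sub_le hε z)
    congr 1; ext y
    rw [ENNReal.rpow_ofNat, sq, hss]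
  have h4 : ∀ y, (s y * ‖g y‖ₑ) ^ (2 : ℝ) =
      ENNReal.ofReal (mollifier n ε (z - y)) * ‖g y‖ₑ ^ 2 := fun y => by
    rw [ENNReal.rpow_ofNat, mul_pow, sq, hss]
  simp only [h4, Pi.mul_apply] at h2
  have h5 := h1.trans (h2.trans (mul_le_of_le_one_left zero_le
    (ENNReal.rpow_le_one h3 (by norm_num))))
  calc _ ≤ _ := pow_le_pow_left₀ zero_le h5 2
    _ = _ := by
      rw [← ENNReal.rpow_natCast, ← ENNReal.rpow_mul]; norm_num

theorem measurable_mollifier_kernel (ε : ℝ) : Measurable fun p : E n × E n =>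
    ENNReal.ofReal (mollifier n ε ((1 - ε) • p.1 - p.2)) :=
  (ENNReal.continuous_ofReal.comp
    ((contDiff_mollifier ε).continuous.comp (by fun_prop))).measurable

theorem lintegral_lintegral_mul_le {α : Type*} [MeasurableSpace α] {μ : Measure α} [SFinite μ]
    {k : α × α → ENNReal} (hk : Measurable k) {c : ENNReal} (hc : c ≠ ⊤)
    (hkc : ∀ y, ∫⁻ x, k (x, y) ∂μ ≤ c) {G : α → ENNReal} (hG : AEMeasurable G μ) :
    ∫⁻ x, ∫⁻ y, k (x, y) * G y ∂μ ∂μ ≤ c * ∫⁻ y, G y ∂μ := by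
  have hprod : AEMeasurable (fun p : α × α => k p * G p.2) (μ.prod μ) :=
    hk.aemeasurable.mul hG.comp_snd
  rw [lintegral_lintegral_swap (f := fun x y => k (x, y) * G y) hprod,
    ← lintegral_const_mul' _ _ hc]
  refine lintegral_mono fun y => ?_
  have hky : Measurable fun x => k (x, y) := hk.comp measurable_prodMk_right
  rw [lintegral_mul_const _ hky]
  exact mul_le_mul_left (hkc y) _

/-- Schur's test: the kernel has mass at most 1 in y and at most 2^n in x. The sharper factor √(2^n)
is not needed. -/
theorem eLpNorm_mollify_le (hε : 0 < ε) (hε1 : ε ≤ 1 / 2) (hg : MemLp g 2 (ballMeasure n)) :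
    (eLpNorm (mollify ε g) 2 (ballMeasure n)).toReal ≤
      2 ^ n * (eLpNorm g 2 (ballMeasure n)).toReal := by
  have h1 : ∫⁻ x in unitBall n, ‖mollify ε g x‖ₑ ^ 2 ≤
      ENNReal.ofReal (2 ^ n) * ∫⁻ y in unitBall n, ‖g y‖ₑ ^ 2 :=
    (lintegral_mono fun x => enorm_mollify_sq_le hε hg x).trans
      (lintegral_lintegral_mul_le (measurable_mollifier_kernel ε) ENNReal.ofReal_ne_top
        (lintegral_mollifier_comp_le hε hε1) (hg.1.enorm.pow_const 2))
  have hsq : ∀ h : E n → ℂ, eLpNorm h 2 (ballMeasure n) =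
      (∫⁻ x in unitBall n, ‖h x‖ₑ ^ 2) ^ (1 / 2 : ℝ) := fun h => by
    rw [eLpNorm_eq_lintegral_rpow_enorm_toReal (by norm_num) (by norm_num)]
    simp
  have h2 : eLpNorm (mollify ε g) 2 (ballMeasure n) ≤
      ENNReal.ofReal (2 ^ n) * eLpNorm g 2 (ballMeasure n) := by
    rw [hsq, hsq]
    refine (ENNReal.rpow_le_rpow h1 (by norm_num)).trans ?_
    rw [ENNReal.mul_rpow_of_nonneg _ _ (by norm_num)]
    refine mul_le_mul_left ?_ _
    refine (ENNReal.rpow_le_rpow_of_exponent_le ?_ (by norm_num : (1 / 2 : ℝ) ≤ 1)).trans_eq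
      (ENNReal.rpow_one _)
    rw [← ENNReal.ofReal_one]
    exact ENNReal.ofReal_le_ofReal (one_le_pow₀ (by norm_num))
  have h3 := ENNReal.toReal_mono (ENNReal.mul_ne_top ENNReal.ofReal_ne_top hg.eLpNorm_ne_top) h2
  rwa [ENNReal.toReal_mul, ENNReal.toReal_ofReal (by positivity)] at h3

theorem norm_multilinear_le_sum {k : ℕ} (L : (E n) [×k]→L[ℝ] ℂ) :
    ‖L‖ ≤ ∑ w : Fin k → Fin n, ‖L (fun j => EuclideanSpace.single (w j) (1 : ℝ))‖ := by
  refine L.opNorm_le_bound (Finset.sum_nonneg fun _ _ => norm_nonneg _) fun v => ?_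
  have hv : v = fun i => ∑ j, v i j • EuclideanSpace.single j (1 : ℝ) := by
    ext1 i
    simpa using ((EuclideanSpace.basisFun (Fin n) ℝ).sum_repr (v i)).symm
  have h1 : L v = ∑ w : Fin k → Fin n, (∏ i, v i (w i)) •
      L (fun j => EuclideanSpace.single (w j) (1 : ℝ)) := by
    conv_lhs => rw [hv, ContinuousMultilinearMap.map_sum]
    exact Finset.sum_congr rfl fun w _ => L.map_smul_univ _ _
  rw [h1, Finset.sum_mul]
  refine (norm_sum_le _ _).trans (Finset.sum_le_sum fun w _ => ?_)
  rw [norm_smul, mul_comm, norm_prod]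
  gcongr
  exact PiLp.norm_apply_le _ _

theorem MemSobolev.weakDeriv_spec (hu : MemSobolev m u) {k : ℕ} (hk : k ≤ m) (w : Fin k → Fin n) :
    MemLp (weakDeriv w u) 2 (ballMeasure n) ∧ IsWeakDeriv w u (weakDeriv w u) := by
  have h := hu.2 k hk w
  rw [weakDeriv, dif_pos h]
  exact h.choose_spec

theorem MemSobolev.integrableOn (hu : MemSobolev m u) : IntegrableOn u (unitBall n) :=
  hu.1.integrable (by norm_num)

theorem eLpNorm_weakDeriv_le_sobolevNorm {k : ℕ} (hk : k ≤ m) (w : Fin k → Fin n) :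
    (eLpNorm (weakDeriv w u) 2 (ballMeasure n)).toReal ≤ sobolevNorm m u := by
  rw [sobolevNorm]
  apply Real.le_sqrt_of_sq_le
  refine le_trans ?_ (Finset.single_le_sum (f := fun k => ∑ w : Fin k → Fin n,
    (eLpNorm (weakDeriv w u) 2 (ballMeasure n)).toReal ^ 2)
    (fun _ _ => Finset.sum_nonneg fun _ _ => sq_nonneg _)
    (Finset.mem_range.2 (Nat.lt_succ_of_le hk)))
  exact Finset.single_le_sum (f := fun w : Fin k → Fin n =>
    (eLpNorm (weakDeriv w u) 2 (ballMeasure n)).toReal ^ 2) (fun _ _ => sq_nonneg _)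
    (Finset.mem_univ w)

/-- On the ball, the coordinate entries of the derivative tensor are mollified weak derivatives
times (1 − ε)^k ≤ 1. -/
theorem derivNorm_mollify_le (hε : 0 < ε) (hε1 : ε ≤ 1 / 2) (hu : MemSobolev m u) {k : ℕ}
    (hk : k ≤ m) : derivNorm k (mollify ε u) ≤
      Fintype.card (Fin k → Fin n) * 2 ^ n * sobolevNorm m u := by
  have hD : ∀ w : Fin k → Fin n, MemLp (fun x => ‖iteratedFDeriv ℝ k (mollify ε u) x
      (fun j => EuclideanSpace.single (w j) (1 : ℝ))‖) 2 (ballMeasure n) := fun w =>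
    memLp_ball_of_continuous (contDiff_iteratedFDeriv_apply
      (contDiff_ballConv (contDiff_mollifier ε) (hasCompactSupport_mollifier hε) _
        hu.integrableOn) _).continuous.norm
  have h1 : derivNorm k (mollify ε u) ≤ ∑ w : Fin k → Fin n,
      (eLpNorm (fun x => ‖iteratedFDeriv ℝ k (mollify ε u) x
        (fun j => EuclideanSpace.single (w j) (1 : ℝ))‖) 2 (ballMeasure n)).toReal := by
    have hS := memLp_finsetSum' Finset.univ fun w _ => hD w
    have h2 := toReal_eLpNorm_mono_ae (h := iteratedFDeriv ℝ k (mollify ε u)) hS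
      (Filter.Eventually.of_forall fun x => by
        refine (norm_multilinear_le_sum _).trans ?_
        rw [Finset.sum_apply]
        exact Real.le_norm_self _)
    exact h2.trans (toReal_eLpNorm_sum_le _ fun w _ => hD w)
  refine h1.trans ((Finset.sum_le_card_nsmul _ _ (2 ^ n * sobolevNorm m u) fun w _ => ?_).trans_eq
    (by simp [mul_assoc]))
  obtain ⟨hwL, hwd⟩ := hu.weakDeriv_spec hk w
  calc _ ≤ (eLpNorm (mollify ε (weakDeriv w u)) 2 (ballMeasure n)).toReal := by
        refine toReal_eLpNorm_mono_ae (memLp_ball_of_continuous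
          (contDiff_ballConv (contDiff_mollifier ε) (hasCompactSupport_mollifier hε) _
            (hwL.integrable (by norm_num))).continuous) ?_
        refine (ae_restrict_iff' measurableSet_ball).2 (Filter.Eventually.of_forall fun x hx => ?_)
        rw [norm_norm, mollify_weakDeriv hε (by linarith) hu.integrableOn hwd (by simpa using hx),
          norm_smul, norm_pow]
        refine mul_le_of_le_one_left (norm_nonneg _) (pow_le_one₀ (norm_nonneg _) ?_)
        rw [Real.norm_of_nonneg (by linarith)]
        linarith
    _ ≤ 2 ^ n * (eLpNorm (weakDeriv w u) 2 (ballMeasure n)).toReal := eLpNorm_mollify_le hε hε1 hwL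
    _ ≤ _ := by gcongr; exact eLpNorm_weakDeriv_le_sobolevNorm hk w

theorem exists_smoothNorm_mollify_le (n m : ℕ) : ∃ C : ℝ, 0 < C ∧ ∀ (u : E n → ℂ) (ε : ℝ),
    0 < ε → ε ≤ 1 / 2 → MemSobolev m u → smoothNorm m (mollify ε u) ≤ C * sobolevNorm m u := by
  refine ⟨∑ k ∈ Finset.range (m + 1), ((Fintype.card (Fin k → Fin n) * 2 ^ n : ℝ) + 1),
    Finset.sum_pos (fun _ _ => by positivity) (by simp), fun u ε hε hε1 hu => ?_⟩
  rw [smoothNorm, Finset.sum_mul]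
  refine Finset.sum_le_sum fun k hk => ?_
  refine (derivNorm_mollify_le hε hε1 hu (by simpa [Nat.lt_succ_iff] using hk)).trans ?_
  have : 0 ≤ sobolevNorm m u := Real.sqrt_nonneg _
  linarith

/-! ### Convergence of the mollification -/

/-- The mollifier has integral one, is at most 1/(ε^n ∫ bump), and vanishes off a ball of volume ε^n
|𝔹|. So the error is at most a mean oscillation, with a factor free of ε. -/
theorem norm_mollify_sub_le (hε : 0 < ε) (hu : IntegrableOn u (unitBall n)) {x : E n}
    (hx : x ∈ unitBall n) : ‖mollify ε u x - u x‖ ≤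
      ((volume : Measure (E n)).real (unitBall n) / ∫ z : E n, bump n z) *
        ⨍ y in Metric.closedBall ((1 - ε) • x) ε,
          ‖(unitBall n).indicator u y - (unitBall n).indicator u x‖ := by
  set U := (unitBall n).indicator u with hU
  set z := (1 - ε) • x with hz
  have hUi : Integrable U := hu.integrable_indicator measurableSet_ball
  have hI := integral_bump_pos (n := n)
  have hUx : U x = u x := Set.indicator_of_mem hx u
  have hk : Integrable fun y => mollifier n ε (z - y) := (integrable_mollifier hε).comp_sub_left z
  have hkU : Integrable fun y => mollifier n ε (z - y) • U y := by
    obtain ⟨C, hC⟩ := (hasCompactSupport_mollifier (n := n) hε).exists_bound_of_continuous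
      (contDiff_mollifier ε).continuous
    exact hUi.bdd_smul C ((contDiff_mollifier ε).continuous.comp
      (by fun_prop : Continuous fun y => z - y)).aestronglyMeasurable
      (Filter.Eventually.of_forall fun y => hC _)
  have e1 : mollify ε u x = ∫ y, mollifier n ε (z - y) • U y := by
    rw [mollify, ballConv, ← integral_indicator measurableSet_ball]
    congr 1; ext y
    by_cases hy : y ∈ unitBall n
    · simp [hU, Set.indicator_of_mem hy, hz]
    · simp [hU, Set.indicator_of_notMem hy]
  have e2 : u x = ∫ y, mollifier n ε (z - y) • U x := by
    rw [integral_smul_const, integral_sub_left_eq_self (mollifier n ε) volume z,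
      integral_mollifier hε, one_smul, hUx]
  rw [e1, e2, ← integral_sub hkU (hk.smul_const _)]
  have e3 : ∫ y, (mollifier n ε (z - y) • U y - mollifier n ε (z - y) • U x) =
      ∫ y in Metric.closedBall z ε, mollifier n ε (z - y) • (U y - U x) := by
    rw [setIntegral_eq_integral_of_forall_compl_eq_zero]
    · simp only [smul_sub]
    · intro y hy
      rw [Metric.mem_closedBall, dist_comm, dist_eq_norm, not_le] at hy
      rw [mollifier_eq_zero hε hy.le, zero_smul]
  have hUc : IntegrableOn (fun y => ‖U y - U x‖) (Metric.closedBall z ε) :=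
    (hUi.integrableOn.sub (integrableOn_const (by
      exact measure_closedBall_lt_top.ne))).norm
  rw [e3, setAverage_eq, smul_eq_mul, Measure.addHaar_real_closedBall volume z hε.le,
    finrank_euclideanSpace_fin]
  calc _ ≤ ∫ y in Metric.closedBall z ε, (ε ^ n * ∫ z : E n, bump n z)⁻¹ * ‖U y - U x‖ := by
        refine norm_integral_le_of_norm_le (hUc.const_mul _) (Filter.Eventually.of_forall fun y => ?_)
        rw [norm_smul, Real.norm_of_nonneg (mollifier_nonneg hε _)]
        gcongr
        exact mollifier_le hε _
    _ = _ := by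
      rw [integral_const_mul]
      have hV := volume_unitBall_pos (n := n)
      have := pow_pos hε n
      rw [← mul_assoc]
      congr 1
      field_simp

/-- The averaging balls are centred at (1 − ε)x, not at x, but contain x because |x − (1 − ε)x| =
ε|x| ≤ ε; Lebesgue differentiation allows such balls. -/
theorem ae_tendsto_mollify (hu : IntegrableOn u (unitBall n)) {e : ℕ → ℝ} (he : ∀ k, 0 < e k)
    (he0 : Filter.Tendsto e Filter.atTop (nhds 0)) :
    ∀ᵐ x ∂(ballMeasure n), Filter.Tendsto (fun k => mollify (e k) u x) Filter.atTop
      (nhds (u x)) := by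
  refine (ae_restrict_iff' measurableSet_ball).2 ?_
  have hUi : Integrable ((unitBall n).indicator u) := hu.integrable_indicator measurableSet_ball
  filter_upwards [IsUnifLocDoublingMeasure.ae_tendsto_average_norm_sub volume
    hUi.locallyIntegrable 1] with x hx hxb
  have h1 := hx (l := Filter.atTop) (fun k => (1 - e k) • x) e
    (tendsto_nhdsWithin_iff.2 ⟨he0, Filter.Eventually.of_forall he⟩)
    (Filter.Eventually.of_forall fun k => by
      have hx1 : ‖x‖ < 1 := by simpa using hxb
      have : x - (1 - e k) • x = e k • x := by rw [sub_smul, one_smul]; abel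
      rw [Metric.mem_closedBall, dist_eq_norm, this, norm_smul, Real.norm_of_nonneg (he k).le]
      nlinarith [he k])
  rw [tendsto_iff_norm_sub_tendsto_zero]
  refine squeeze_zero (fun _ => norm_nonneg _) (fun k => norm_mollify_sub_le (he k) hu hxb) ?_
  simpa using h1.const_mul _

end WaveMaps
end

noncomputable section
namespace WaveMaps

/-! ### Powers in the algebra of smooth radial functions -/

variable {n m : ℕ} {f g U V q : E n → ℂ} {K : ℝ}

/-- `K` is an admissible constant in the algebra inequality. -/
def IsAlgebraConst (n m : ℕ) (K : ℝ) : Prop :=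
  0 < K ∧ ∀ f g : E n → ℂ, IsSmoothRadial f → IsSmoothRadial g →
    smoothNorm m (f * g) ≤ K * smoothNorm m f * smoothNorm m g

theorem IsAlgebraConst.mul_le (hK : IsAlgebraConst n m K) (hf : IsSmoothRadial f)
    (hg : IsSmoothRadial g) :
    K * smoothNorm m (f * g) ≤ (K * smoothNorm m f) * (K * smoothNorm m g) := by
  have := mul_le_mul_of_nonneg_left (hK.2 f g hf hg) hK.1.le
  linarith

/-- The power zero is left out because `K * smoothNorm m 1` need not be at most one. -/
theorem IsAlgebraConst.pow_le (hK : IsAlgebraConst n m K) (hf : IsSmoothRadial f) {p : ℕ}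
    (hp : 1 ≤ p) : K * smoothNorm m (f ^ p) ≤ (K * smoothNorm m f) ^ p := by
  induction p, hp using Nat.le_induction with
  | base => simp
  | succ p _ ih =>
    rw [pow_succ, pow_succ]
    refine (hK.mul_le (hf.pow p) hf).trans ?_
    have := mul_nonneg hK.1.le (smoothNorm_nonneg m f)
    gcongr

theorem IsAlgebraConst.pow_mul_le (hK : IsAlgebraConst n m K) (hf : IsSmoothRadial f)
    (hg : IsSmoothRadial g) (p : ℕ) :
    K * smoothNorm m (f ^ p * g) ≤ (K * smoothNorm m f) ^ p * (K * smoothNorm m g) := by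
  induction p with
  | zero => simp
  | succ p ih =>
    have h1 := hK.mul_le hf ((hf.pow p).mul hg)
    have h2 := mul_nonneg hK.1.le (smoothNorm_nonneg m f)
    rw [pow_succ', mul_assoc, pow_succ', mul_assoc]
    exact h1.trans (mul_le_mul_of_nonneg_left ih h2)

theorem IsAlgebraConst.pow_sub_pow_le (hK : IsAlgebraConst n m K) (hU : IsSmoothRadial U)
    (hV : IsSmoothRadial V) (p : ℕ) :
    K * smoothNorm m (U ^ (p + 1) - V ^ (p + 1)) ≤
      (p + 1) * (K * smoothNorm m U + K * smoothNorm m V) ^ p * (K * smoothNorm m (U - V)) := by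
  set a := K * smoothNorm m U + K * smoothNorm m V with ha
  have hu : 0 ≤ K * smoothNorm m U := mul_nonneg hK.1.le (smoothNorm_nonneg m _)
  have hv : 0 ≤ K * smoothNorm m V := mul_nonneg hK.1.le (smoothNorm_nonneg m _)
  have hd : 0 ≤ K * smoothNorm m (U - V) := mul_nonneg hK.1.le (smoothNorm_nonneg m _)
  have ha0 : 0 ≤ a := add_nonneg hu hv
  induction p with
  | zero => simp
  | succ p ih =>
    have e : U ^ (p + 1 + 1) - V ^ (p + 1 + 1) =
        U * (U ^ (p + 1) - V ^ (p + 1)) + (U - V) * V ^ (p + 1) := by ring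
    have hUp := (hU.pow (p + 1)).sub (hV.pow (p + 1))
    have h1 := hK.mul_le hU hUp
    have h2 := hK.mul_le (hU.sub hV) (hV.pow (p + 1))
    have h3 := (hU.mul hUp).smoothNorm_add_le (m := m) ((hU.sub hV).mul (hV.pow (p + 1)))
    have h4 := mul_le_mul_of_nonneg_left h3 hK.1.le
    have h5 : K * smoothNorm m (V ^ (p + 1)) ≤ a ^ (p + 1) :=
      (hK.pow_le hV (by omega)).trans (pow_le_pow_left₀ hv (by linarith) _)
    have h6 : (K * smoothNorm m U) * (K * smoothNorm m (U ^ (p + 1) - V ^ (p + 1))) ≤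
        a * ((p + 1) * a ^ p * (K * smoothNorm m (U - V))) :=
      mul_le_mul (by linarith) ih (mul_nonneg hK.1.le (smoothNorm_nonneg m _)) ha0
    have h7 := mul_le_mul_of_nonneg_left h5 hd
    rw [e]
    push_cast
    rw [pow_succ a p] at h7 ⊢
    linarith

/-! ### The power series of the nonlinearity -/

/-- Taylor coefficients of `cos (2 z) - 1` (for `s = 2`) and of `sin (2 z) - 2 z` (for `s = 3`). -/
def seriesCoeff (s j : ℕ) : ℂ := (-1) ^ (j + 1) * 2 ^ (2 * j + s) / ((2 * j + s).factorial : ℂ)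

theorem norm_seriesCoeff (s j : ℕ) :
    ‖seriesCoeff s j‖ = 2 ^ (2 * j + s) / ((2 * j + s).factorial : ℝ) := by
  simp [seriesCoeff]

/-- The factor 2j + s is the one produced by differences of powers. With p = 2j + s, the bounds p ≤
2^p and Q^j ≤ (1 + Q)^p leave the exponential series at 4(1 + Q)R as majorant. -/
theorem summable_seriesCoeff (s : ℕ) {Q R : ℝ} (hQ : 0 ≤ Q) (hR : 0 ≤ R) :
    Summable fun j : ℕ => ‖seriesCoeff s j‖ * (((2 * j + s : ℕ) : ℝ) * (Q ^ j * R ^ (2 * j + s))) := by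
  have hinj : Function.Injective fun j : ℕ => 2 * j + s := fun a b h => by
    simp only at h; omega
  have h1 := (Real.summable_pow_div_factorial (4 * ((1 + Q) * R))).comp_injective hinj
  refine Summable.of_nonneg_of_le (fun j => by positivity) (fun j => ?_) h1
  simp only [Function.comp_apply]
  set p := 2 * j + s with hp
  rw [norm_seriesCoeff, ← hp, mul_pow, mul_pow, show (4 : ℝ) = 2 * 2 by norm_num, mul_pow]
  have h2 : (p : ℝ) ≤ 2 ^ p := by exact_mod_cast Nat.lt_two_pow_self.le
  have h3 : Q ^ j ≤ (1 + Q) ^ p :=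
    (pow_le_pow_left₀ hQ (by linarith) j).trans (pow_le_pow_right₀ (by linarith) (by omega))
  calc _ ≤ 2 ^ p / (p.factorial : ℝ) * (2 ^ p * ((1 + Q) ^ p * R ^ p)) := by gcongr
    _ = _ := by ring

/-- Partial sums of the power series `∑ c_j q^j U^(2 j + s)`. -/
def seriesPart (q : E n → ℂ) (s k : ℕ) (U : E n → ℂ) : E n → ℂ :=
  ∑ j ∈ Finset.range k, seriesCoeff s j • (q ^ j * U ^ (2 * j + s))

theorem isSmoothRadial_seriesPart (hq : IsSmoothRadial q) (hU : IsSmoothRadial U) (s k : ℕ) :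
    IsSmoothRadial (seriesPart q s k U) :=
  IsSmoothRadial.sum fun j _ => ((hq.pow j).mul (hU.pow _)).const_smul _

/-- All exponents are at least 2, so beside the difference one more factor of the sum of norms
splits off; the remaining powers are absorbed by b ≥ 1. The constant is the full series, hence
independent of the truncation `k`. -/
theorem IsAlgebraConst.exists_seriesPart_sub_le (hK : IsAlgebraConst n m K)
    (hq : IsSmoothRadial q) (s : ℕ) {b : ℝ} (hb : 1 ≤ b) : ∃ C : ℝ, 0 ≤ C ∧
      ∀ (k : ℕ) (U V : E n → ℂ), IsSmoothRadial U → IsSmoothRadial V →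
        K * smoothNorm m U + K * smoothNorm m V ≤ b →
        K * smoothNorm m (seriesPart q (s + 2) k U - seriesPart q (s + 2) k V) ≤
          C * (K * smoothNorm m U + K * smoothNorm m V) * (K * smoothNorm m (U - V)) := by
  have hQ : 0 ≤ K * smoothNorm m q := mul_nonneg hK.1.le (smoothNorm_nonneg m _)
  have hsum := summable_seriesCoeff (s + 2) hQ (zero_le_one.trans hb)
  refine ⟨∑' j, ‖seriesCoeff (s + 2) j‖ * (((2 * j + (s + 2) : ℕ) : ℝ) *
    ((K * smoothNorm m q) ^ j * b ^ (2 * j + (s + 2)))), tsum_nonneg fun j => ?_,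
    fun k U V hU hV hab => ?_⟩
  · have := zero_le_one.trans hb
    positivity
  set a := K * smoothNorm m U + K * smoothNorm m V with ha
  set D := K * smoothNorm m (U - V) with hD
  set Q := K * smoothNorm m q
  have ha0 : 0 ≤ a := add_nonneg (mul_nonneg hK.1.le (smoothNorm_nonneg m _))
    (mul_nonneg hK.1.le (smoothNorm_nonneg m _))
  have hD0 : 0 ≤ D := mul_nonneg hK.1.le (smoothNorm_nonneg m _)
  have hdiff : seriesPart q (s + 2) k U - seriesPart q (s + 2) k V =
      ∑ j ∈ Finset.range k, seriesCoeff (s + 2) j •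
        (q ^ j * (U ^ (2 * j + (s + 2)) - V ^ (2 * j + (s + 2)))) := by
    rw [seriesPart, seriesPart, ← Finset.sum_sub_distrib]
    refine Finset.sum_congr rfl fun j _ => ?_
    rw [← smul_sub, mul_sub]
  have hterm : ∀ j, IsSmoothRadial (U ^ (2 * j + (s + 2)) - V ^ (2 * j + (s + 2))) := fun j =>
    (hU.pow _).sub (hV.pow _)
  have h1 : smoothNorm m (seriesPart q (s + 2) k U - seriesPart q (s + 2) k V) ≤
      ∑ j ∈ Finset.range k, ‖seriesCoeff (s + 2) j‖ *
        smoothNorm m (q ^ j * (U ^ (2 * j + (s + 2)) - V ^ (2 * j + (s + 2)))) := by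
    rw [hdiff]
    refine (IsSmoothRadial.smoothNorm_sum_le _ fun j =>
      ((hq.pow j).mul (hterm j)).const_smul _).trans_eq ?_
    exact Finset.sum_congr rfl fun j _ => ((hq.pow j).mul (hterm j)).smoothNorm_const_smul _
  refine (mul_le_mul_of_nonneg_left h1 hK.1.le).trans ?_
  rw [mul_assoc, ← tsum_mul_right, Finset.mul_sum]
  refine le_trans (Finset.sum_le_sum fun j _ => ?_)
    ((hsum.mul_right _).sum_le_tsum _ fun j _ => by have := zero_le_one.trans hb; positivity)
  have h2 := hK.pow_mul_le hq (hterm j) j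
  have h3 := hK.pow_sub_pow_le hU hV (2 * j + (s + 1))
  rw [← ha, ← hD] at h3
  have h4 : a ^ (2 * j + (s + 1)) ≤ a * b ^ (2 * j + (s + 2)) := by
    rw [show 2 * j + (s + 1) = (2 * j + s) + 1 by ring, pow_succ']
    refine mul_le_mul_of_nonneg_left ?_ ha0
    exact (pow_le_pow_left₀ ha0 hab _).trans (pow_le_pow_right₀ hb (by omega))
  have h5 : K * smoothNorm m (U ^ (2 * j + (s + 2)) - V ^ (2 * j + (s + 2))) ≤
      ((2 * j + (s + 2) : ℕ) : ℝ) * (a * b ^ (2 * j + (s + 2))) * D := by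
    refine h3.trans ?_
    refine mul_le_mul_of_nonneg_right ?_ hD0
    refine mul_le_mul (by push_cast; linarith) h4 (by positivity) (by positivity)
  have h6 := h2.trans (mul_le_mul_of_nonneg_left h5 (by positivity : 0 ≤ Q ^ j))
  have h7 := mul_le_mul_of_nonneg_left h6 (norm_nonneg (seriesCoeff (s + 2) j))
  refine le_trans (le_of_eq ?_) (h7.trans (le_of_eq ?_)) <;> ring

/-- Truncation and argument vary together: filling up with zeros gives full series, to which
dominated convergence for sums applies. -/
theorem tendsto_seriesPart {s : ℕ} (hs : 1 ≤ s) {F : ℕ → E n → ℂ} {x : E n} {z : ℂ}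
    (hF : Filter.Tendsto (fun k => F k x) Filter.atTop (nhds z)) :
    Filter.Tendsto (fun k => seriesPart q s k (F k) x) Filter.atTop
      (nhds (∑' j, seriesCoeff s j * (q x ^ j * z ^ (2 * j + s)))) := by
  obtain ⟨R, hR⟩ := (Metric.isBounded_range_of_tendsto _ hF).exists_norm_le
  have hR' : ∀ k, ‖F k x‖ ≤ R := fun k => hR _ ⟨k, rfl⟩
  have hR0 : 0 ≤ R := (norm_nonneg _).trans (hR' 0)
  have e : ∀ k, seriesPart q s k (F k) x = ∑' j, if j < k then
      seriesCoeff s j * (q x ^ j * F k x ^ (2 * j + s)) else 0 := by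
    intro k
    rw [tsum_eq_sum (s := Finset.range k) fun j hj => by
      rw [if_neg (by simpa using hj)]]
    rw [seriesPart, Finset.sum_apply]
    refine Finset.sum_congr rfl fun j hj => ?_
    rw [if_pos (by simpa using hj)]
    simp
  simp only [e]
  refine tendsto_tsum_of_dominated_convergence (summable_seriesCoeff s (norm_nonneg (q x)) hR0)
    (fun j => ?_) (Filter.Eventually.of_forall fun k j => ?_)
  · refine Filter.Tendsto.congr' (f₁ := fun k =>
      seriesCoeff s j * (q x ^ j * F k x ^ (2 * j + s))) ?_
      (((hF.pow _).const_mul _).const_mul _)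
    filter_upwards [Filter.eventually_gt_atTop j] with k hk
    rw [if_pos hk]
  · have h1 : (1 : ℝ) ≤ ((2 * j + s : ℕ) : ℝ) := by exact_mod_cast (by omega : 1 ≤ 2 * j + s)
    split_ifs
    · rw [norm_mul, norm_mul, norm_pow, norm_pow]
      refine mul_le_mul_of_nonneg_left ?_ (norm_nonneg _)
      refine le_trans ?_ (le_mul_of_one_le_left (by positivity) h1)
      gcongr
      exact hR' k
    · rw [norm_zero]; positivity

theorem hasSum_cos_series {ρ : ℂ} (hρ : ρ ≠ 0) (z : ℂ) :
    HasSum (fun j => seriesCoeff 2 j * ((ρ ^ 2) ^ j * z ^ (2 * j + 2)))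
      ((Complex.cos (2 * (ρ * z)) - 1) / ρ ^ 2) := by
  have h := (hasSum_nat_add_iff' 1).2 (Complex.hasSum_cos (2 * (ρ * z)))
  simp only [Finset.range_one, Finset.sum_singleton, pow_zero, mul_zero, Nat.factorial_zero,
    Nat.cast_one, mul_one, div_one] at h
  refine (h.div_const (ρ ^ 2)).congr_fun fun j => ?_
  rw [seriesCoeff, show 2 * (j + 1) = 2 * j + 2 by ring, mul_pow, mul_pow]
  field_simp
  ring

theorem hasSum_sin_series {ρ : ℂ} (hρ : ρ ≠ 0) (z : ℂ) :
    HasSum (fun j => seriesCoeff 3 j * ((ρ ^ 2) ^ j * z ^ (2 * j + 3)))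
      ((Complex.sin (2 * (ρ * z)) - 2 * (ρ * z)) / ρ ^ 3) := by
  have h := (hasSum_nat_add_iff' 1).2 (Complex.hasSum_sin (2 * (ρ * z)))
  simp only [Finset.range_one, Finset.sum_singleton, pow_zero, mul_zero, zero_add,
    Nat.factorial_one, Nat.cast_one, pow_one, one_mul, div_one] at h
  refine (h.div_const (ρ ^ 3)).congr_fun fun j => ?_
  rw [seriesCoeff, show 2 * (j + 1) + 1 = 2 * j + 3 by ring, mul_pow, mul_pow]
  field_simp
  ring

/-! ### The coefficient functions -/

/-- The smooth radial function `ξ ↦ |ξ|²`. -/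
def normSq (n : ℕ) (x : E n) : ℂ := ((‖x‖ ^ 2 : ℝ) : ℂ)

theorem isSmoothRadial_normSq : IsSmoothRadial (normSq n) :=
  ⟨Complex.ofRealCLM.contDiff.comp (contDiff_norm_sq ℝ), fun R => by ext x; simp [normSq]⟩

/-- The smooth radial extension of `ρ ↦ sin (2 f₀(ρ)) / ρ`. -/
def sinCoeff (n d : ℕ) (x : E n) : ℂ :=
  ((4 / Real.sqrt ((d : ℝ) - 2) * (1 - ‖x‖ ^ 2 / ((d : ℝ) - 2)) /
    (1 + ‖x‖ ^ 2 / ((d : ℝ) - 2)) ^ 2 : ℝ) : ℂ)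

/-- The smooth radial extension of `ρ ↦ cos (2 f₀(ρ))`. -/
def cosCoeff (n d : ℕ) (x : E n) : ℂ :=
  ((2 * ((1 - ‖x‖ ^ 2 / ((d : ℝ) - 2)) / (1 + ‖x‖ ^ 2 / ((d : ℝ) - 2))) ^ 2 - 1 : ℝ) : ℂ)

variable {d : ℕ}

theorem one_add_normSq_div_pos (hd : 3 ≤ d) (x : E n) : 0 < 1 + ‖x‖ ^ 2 / ((d : ℝ) - 2) := by
  have : (3 : ℝ) ≤ d := by exact_mod_cast hd
  have h : 0 < (d : ℝ) - 2 := by linarith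
  positivity

theorem isSmoothRadial_sinCoeff (hd : 3 ≤ d) : IsSmoothRadial (sinCoeff n d) := by
  have h1 : ContDiff ℝ ∞ fun x : E n => ‖x‖ ^ 2 / ((d : ℝ) - 2) :=
    (contDiff_norm_sq ℝ).div_const _
  refine ⟨Complex.ofRealCLM.contDiff.comp (ContDiff.div (contDiff_const.mul
    (contDiff_const.sub h1)) ((contDiff_const.add h1).pow 2)
    fun x => (pow_pos (one_add_normSq_div_pos hd x) 2).ne'), fun R => by ext x; simp [sinCoeff]⟩

theorem isSmoothRadial_cosCoeff (hd : 3 ≤ d) : IsSmoothRadial (cosCoeff n d) := by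
  have h1 : ContDiff ℝ ∞ fun x : E n => ‖x‖ ^ 2 / ((d : ℝ) - 2) :=
    (contDiff_norm_sq ℝ).div_const _
  refine ⟨Complex.ofRealCLM.contDiff.comp ((contDiff_const.mul ((ContDiff.div
    (contDiff_const.sub h1) (contDiff_const.add h1)
    fun x => (one_add_normSq_div_pos hd x).ne').pow 2)).sub contDiff_const),
    fun R => by ext x; simp [cosCoeff]⟩

/-- Half of f₀ is an arctangent, so the half-angle substitution makes cosine and sine rational; this
is why the coefficient functions extend smoothly through the origin. -/
theorem cos_f₀ (hd : 3 ≤ d) (ρ : ℝ) : Real.cos (f₀ d ρ) =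
    (1 - ρ ^ 2 / ((d : ℝ) - 2)) / (1 + ρ ^ 2 / ((d : ℝ) - 2)) := by
  have h3 : (3 : ℝ) ≤ d := by exact_mod_cast hd
  have h : 0 < (d : ℝ) - 2 := by linarith
  have h1 : 0 < 1 + ρ ^ 2 / ((d : ℝ) - 2) := by positivity
  rw [f₀, Real.cos_two_mul, Real.cos_sq_arctan, div_pow, Real.sq_sqrt h.le]
  field_simp
  ring

theorem sin_f₀ (hd : 3 ≤ d) (ρ : ℝ) : Real.sin (f₀ d ρ) =
    2 / Real.sqrt ((d : ℝ) - 2) * ρ / (1 + ρ ^ 2 / ((d : ℝ) - 2)) := by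
  have h3 : (3 : ℝ) ≤ d := by exact_mod_cast hd
  have h : 0 < (d : ℝ) - 2 := by linarith
  have hs : (ρ / Real.sqrt ((d : ℝ) - 2)) ^ 2 = ρ ^ 2 / ((d : ℝ) - 2) := by
    rw [div_pow, Real.sq_sqrt h.le]
  have h1 : 0 < 1 + ρ ^ 2 / ((d : ℝ) - 2) := by positivity
  have h2 : Real.sqrt (1 + ρ ^ 2 / ((d : ℝ) - 2)) ^ 2 = 1 + ρ ^ 2 / ((d : ℝ) - 2) :=
    Real.sq_sqrt h1.le
  have h4 : 0 < Real.sqrt (1 + ρ ^ 2 / ((d : ℝ) - 2)) := Real.sqrt_pos.2 h1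
  rw [f₀, Real.sin_two_mul, Real.sin_arctan, Real.cos_arctan, hs]
  calc _ = 2 / Real.sqrt ((d : ℝ) - 2) * ρ / Real.sqrt (1 + ρ ^ 2 / ((d : ℝ) - 2)) ^ 2 := by
        have := Real.sqrt_pos.2 h
        field_simp
    _ = _ := by rw [h2]

theorem ofReal_cos_two_f₀ (hd : 3 ≤ d) (x : E n) :
    Complex.cos (2 * (f₀ d ‖x‖ : ℂ)) = cosCoeff n d x := by
  rw [cosCoeff, ← cos_f₀ hd, ← Real.cos_two_mul]
  push_cast
  rfl

theorem ofReal_sin_two_f₀ (hd : 3 ≤ d) (x : E n) :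
    Complex.sin (2 * (f₀ d ‖x‖ : ℂ)) = (‖x‖ : ℂ) * sinCoeff n d x := by
  have h : Real.sin (2 * f₀ d ‖x‖) = ‖x‖ * (4 / Real.sqrt ((d : ℝ) - 2) *
      (1 - ‖x‖ ^ 2 / ((d : ℝ) - 2)) / (1 + ‖x‖ ^ 2 / ((d : ℝ) - 2)) ^ 2) := by
    rw [Real.sin_two_mul, sin_f₀ hd, cos_f₀ hd]
    generalize 1 + ‖x‖ ^ 2 / ((d : ℝ) - 2) = c
    ring
  rw [sinCoeff, ← Complex.ofReal_mul, ← h]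
  push_cast
  rfl

theorem taylorRemainder_eq (d : ℕ) (ρ : ℝ) (z : ℂ) :
    taylorRemainder d ρ z = Complex.sin (2 * (f₀ d ρ : ℂ)) * (Complex.cos (2 * z) - 1) +
      Complex.cos (2 * (f₀ d ρ : ℂ)) * (Complex.sin (2 * z) - 2 * z) := by
  have hη : ∀ w : ℂ, deriv η w = 2 * Complex.cos (2 * w) - 2 := by
    intro w
    have h1 : HasDerivAt (fun w : ℂ => 2 * w) 2 w := by simpa using (hasDerivAt_id w).const_mul 2
    have h2 := (h1.csin.sub h1).deriv
    have h3 : deriv η w = Complex.cos (2 * w) * 2 - 2 := h2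
    rw [h3]; ring
  rw [taylorRemainder, hη, η, η, mul_add, Complex.sin_add]
  ring

/-- The factor sin(2f₀) supplies one power of ρ, so the cosine series is divided by ρ² only, and the
sine series by ρ³; both divisions are exact. -/
theorem nonlinearity_snd_eq (hd : 3 ≤ d) (u : (ℝ → ℂ) × (ℝ → ℂ)) {x : E n} (hx : x ≠ 0) :
    (nonlinearity d u).2 ‖x‖ = -(((d : ℂ) - 1) / 2) *
      (sinCoeff n d x * (∑' j, seriesCoeff 2 j * (normSq n x ^ j * u.1 ‖x‖ ^ (2 * j + 2))) +
        cosCoeff n d x * ∑' j, seriesCoeff 3 j * (normSq n x ^ j * u.1 ‖x‖ ^ (2 * j + 3))) := by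
  have hρ : (‖x‖ : ℂ) ≠ 0 := by exact_mod_cast (norm_pos_iff.2 hx).ne'
  have hq : normSq n x = (‖x‖ : ℂ) ^ 2 := by simp [normSq]
  rw [hq, (hasSum_cos_series hρ _).tsum_eq, (hasSum_sin_series hρ _).tsum_eq, nonlinearity]
  simp only
  rw [taylorRemainder_eq, ofReal_sin_two_f₀ hd x, ofReal_cos_two_f₀ hd x]
  field_simp

/-- Polynomial approximations of the nonlinearity. -/
def approxNonlinearity (d k : ℕ) (U : E n → ℂ) : E n → ℂ :=
  (-(((d : ℂ) - 1) / 2)) • (sinCoeff n d * seriesPart (normSq n) 2 k U +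
    cosCoeff n d * seriesPart (normSq n) 3 k U)

theorem isSmoothRadial_approxNonlinearity (hd : 3 ≤ d) (k : ℕ) (hU : IsSmoothRadial U) :
    IsSmoothRadial (approxNonlinearity d k U) :=
  (((isSmoothRadial_sinCoeff hd).mul (isSmoothRadial_seriesPart isSmoothRadial_normSq hU _ _)).add
    ((isSmoothRadial_cosCoeff hd).mul
      (isSmoothRadial_seriesPart isSmoothRadial_normSq hU _ _))).const_smul _

theorem tendsto_approxNonlinearity (hd : 3 ≤ d) (u : (ℝ → ℂ) × (ℝ → ℂ)) {F : ℕ → E n → ℂ}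
    {x : E n} (hx : x ≠ 0)
    (hF : Filter.Tendsto (fun k => F k x) Filter.atTop (nhds (u.1 ‖x‖))) :
    Filter.Tendsto (fun k => approxNonlinearity d k (F k) x) Filter.atTop
      (nhds (radial n (nonlinearity d u).2 x)) := by
  rw [radial, nonlinearity_snd_eq hd u hx]
  exact (((tendsto_seriesPart (by norm_num) hF).const_mul _).add
    ((tendsto_seriesPart (by norm_num) hF).const_mul _)).const_mul _

theorem exists_approxNonlinearity_sub_le (hd : 3 ≤ d) (hm : 2 ≤ m) (hn : n + 1 = 2 * m)
    (δ : ℝ) : ∃ C : ℝ, 0 ≤ C ∧ ∀ (k : ℕ) (U V : E n → ℂ),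
      IsSmoothRadial U → IsSmoothRadial V → smoothNorm m U ≤ δ → smoothNorm m V ≤ δ →
      smoothNorm m (approxNonlinearity d k U - approxNonlinearity d k V) ≤
        C * (smoothNorm m U + smoothNorm m V) * smoothNorm m (U - V) := by
  obtain ⟨K, hK0, hK1⟩ := exists_smoothNorm_mul_le hm hn
  have hK : IsAlgebraConst n m K := ⟨hK0, hK1⟩
  -- The radius on which the power series are estimated, raised to at least one.
  have hb : 1 ≤ max 1 (K * δ + K * δ) := le_max_left _ _
  obtain ⟨C₁, hC₁, h₁⟩ := hK.exists_seriesPart_sub_le isSmoothRadial_normSq 0 hb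
  obtain ⟨C₂, hC₂, h₂⟩ := hK.exists_seriesPart_sub_le isSmoothRadial_normSq 1 hb
  have hA := isSmoothRadial_sinCoeff (n := n) hd
  have hB := isSmoothRadial_cosCoeff (n := n) hd
  have hA0 := smoothNorm_nonneg m (sinCoeff n d)
  have hB0 := smoothNorm_nonneg m (cosCoeff n d)
  refine ⟨‖-(((d : ℂ) - 1) / 2)‖ * ((smoothNorm m (sinCoeff n d) * C₁ +
    smoothNorm m (cosCoeff n d) * C₂) * K ^ 2), by positivity, fun k U V hU hV hUδ hVδ => ?_⟩
  have hab : K * smoothNorm m U + K * smoothNorm m V ≤ max 1 (K * δ + K * δ) :=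
    le_trans (by gcongr) (le_max_right _ _)
  have hS : ∀ s {W : E n → ℂ}, IsSmoothRadial W → IsSmoothRadial (seriesPart (normSq n) s k W) :=
    fun s W hW => isSmoothRadial_seriesPart isSmoothRadial_normSq hW s k
  have e : approxNonlinearity d k U - approxNonlinearity d k V = (-(((d : ℂ) - 1) / 2)) •
      (sinCoeff n d * (seriesPart (normSq n) 2 k U - seriesPart (normSq n) 2 k V) +
        cosCoeff n d * (seriesPart (normSq n) 3 k U - seriesPart (normSq n) 3 k V)) := by
    rw [approxNonlinearity, approxNonlinearity, ← smul_sub]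
    congr 1
    ring
  have hD2 := (hS 2 hU).sub (hS 2 hV)
  have hD3 := (hS 3 hU).sub (hS 3 hV)
  rw [e, ((hA.mul hD2).add (hB.mul hD3)).smoothNorm_const_smul, mul_assoc, mul_assoc]
  refine mul_le_mul_of_nonneg_left ?_ (norm_nonneg _)
  have i1 := (hA.mul hD2).smoothNorm_add_le (m := m) (hB.mul hD3)
  have i2 := hK1 _ _ hA hD2
  have i3 := hK1 _ _ hB hD3
  have i4 := mul_le_mul_of_nonneg_left (h₁ k U V hU hV hab) hA0
  have i5 := mul_le_mul_of_nonneg_left (h₂ k U V hU hV hab) hB0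
  simp only [zero_add, Nat.reduceAdd] at i4 i5
  linarith

/-! ### Linear structure of the Sobolev space -/

theorem integrableOn_partialDeriv_smul {k : ℕ} (w : Fin k → Fin n) {φ : E n → ℝ}
    (hφ : ContDiff ℝ ∞ φ) (hc : HasCompactSupport φ) (hf : IntegrableOn f (unitBall n)) :
    IntegrableOn (fun x => partialDeriv w φ x • f x) (unitBall n) := by
  have hpc : Continuous (partialDeriv w φ) := (contDiff_iteratedFDeriv_apply hφ _).continuous
  obtain ⟨B, hB⟩ := (hasCompactSupport_iteratedFDeriv_apply hc
    (fun j => EuclideanSpace.single (w j) (1 : ℝ))).exists_bound_of_continuous hpc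
  exact hf.bdd_smul B hpc.aestronglyMeasurable (Filter.Eventually.of_forall hB)

theorem IsWeakDeriv.sub {k : ℕ} {w : Fin k → Fin n} {f' g' : E n → ℂ}
    (hf : IntegrableOn f (unitBall n)) (hf' : IntegrableOn f' (unitBall n))
    (hg : IntegrableOn g (unitBall n)) (hg' : IntegrableOn g' (unitBall n))
    (h : IsWeakDeriv w f g) (h' : IsWeakDeriv w f' g') : IsWeakDeriv w (f - f') (g - g') := by
  intro φ hφ hc hs
  obtain ⟨B, hB⟩ := hc.exists_bound_of_continuous hφ.continuous
  have hi : ∀ {g : E n → ℂ}, IntegrableOn g (unitBall n) →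
      IntegrableOn (fun x => φ x • g x) (unitBall n) := fun hg =>
    hg.bdd_smul B hφ.continuous.aestronglyMeasurable (Filter.Eventually.of_forall hB)
  simp only [Pi.sub_apply, smul_sub]
  rw [integral_sub (integrableOn_partialDeriv_smul w hφ hc hf)
      (integrableOn_partialDeriv_smul w hφ hc hf'),
    integral_sub (hi hg) (hi hg'), h φ hφ hc hs, h' φ hφ hc hs, smul_sub]

theorem MemSobolev.sub (hf : MemSobolev m f) (hg : MemSobolev m g) : MemSobolev m (f - g) := by
  refine ⟨hf.1.sub hg.1, fun k hk w => ?_⟩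
  obtain ⟨f', hf', h⟩ := hf.2 k hk w
  obtain ⟨g', hg', h'⟩ := hg.2 k hk w
  exact ⟨f' - g', hf'.sub hg', h.sub hf.integrableOn hg.integrableOn
    (hf'.integrable (by norm_num)) (hg'.integrable (by norm_num)) h'⟩

theorem isWeakDeriv_zero {k : ℕ} (w : Fin k → Fin n) : IsWeakDeriv w 0 0 := by
  intro φ _ _ _
  simp

theorem memSobolev_zero : MemSobolev m (0 : E n → ℂ) :=
  ⟨MemLp.zero, fun _ _ w => ⟨0, MemLp.zero, isWeakDeriv_zero w⟩⟩

theorem sobolevNorm_zero : sobolevNorm m (0 : E n → ℂ) = 0 := by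
  have : ∀ (k : ℕ) (w : Fin k → Fin n), eLpNorm (weakDeriv w 0) 2 (ballMeasure n) = 0 := by
    intro k w
    rw [eLpNorm_congr_ae (weakDeriv_ae_eq MemLp.zero (isWeakDeriv_zero w)), eLpNorm_zero]
  simp [sobolevNorm, this]

theorem sobolevNorm_nonneg : 0 ≤ sobolevNorm m f := Real.sqrt_nonneg _

/-! ### The Lipschitz bound -/

theorem radial_comp_isometry (u : ℝ → ℂ) (R : E n ≃ₗᵢ[ℝ] E n) :
    radial n u ∘ R = radial n u := by
  ext x; simp [radial]

theorem mul_sum_mul_le {c C a b e a' b' e' : ℝ} (hc : 0 ≤ c) (hC : 0 ≤ C) (ha : 0 ≤ a)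
    (hb : 0 ≤ b) (he : 0 ≤ e) (ha' : 0 ≤ a') (hb' : 0 ≤ b') (h1 : a ≤ c * a')
    (h2 : b ≤ c * b') (h3 : e ≤ c * e') :
    C * (a + b) * e ≤ (C + 1) * c ^ 2 * (a' + b') * e' := by
  calc C * (a + b) * e ≤ (C + 1) * (c * a' + c * b') * (c * e') := by gcongr; linarith
    _ = _ := by ring

/-- The difference itself is approximated, by differences of partial sums at mollified data, so
linearity of the Sobolev norm is never used. As mollification is linear, the bound involves the norm
of the difference of the data. -/
theorem exists_nonlinearity_sub_le (hd : 3 ≤ d) (hm : 2 ≤ m) (hn : n + 1 = 2 * m) (δ : ℝ) :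
    ∃ C : ℝ, 0 < C ∧ ∀ u v : (ℝ → ℂ) × (ℝ → ℂ), MemSobolev m (radial n u.1) →
      MemSobolev m (radial n v.1) → sobolevNorm m (radial n u.1) ≤ δ →
      sobolevNorm m (radial n v.1) ≤ δ → ∀ m' ≤ m,
      MemSobolev m' (radial n (nonlinearity d u).2 - radial n (nonlinearity d v).2) ∧
      sobolevNorm m' (radial n (nonlinearity d u).2 - radial n (nonlinearity d v).2) ≤
        C * (sobolevNorm m (radial n u.1) + sobolevNorm m (radial n v.1)) *
          sobolevNorm m (radial n u.1 - radial n v.1) := by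
  obtain ⟨C₁, hC₁, h₁⟩ := exists_smoothNorm_mollify_le n m
  obtain ⟨C₂, hC₂, h₂⟩ := exists_approxNonlinearity_sub_le hd hm hn (C₁ * δ)
  obtain ⟨C₃, hC₃, h₃⟩ := exists_sobolevNorm_le_of_tendsto hm hn
  have : Nonempty (Fin n) := ⟨⟨0, by omega⟩⟩
  -- Each of the two norm factors costs one `C₁` under mollification; the added 1 keeps the constant
  -- positive if `C₂` vanishes.
  refine ⟨C₃ * ((C₂ + 1) * C₁ ^ 2), by positivity, fun u v hu hv huδ hvδ m' hm' => ?_⟩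
  set e : ℕ → ℝ := fun k => 1 / ((k : ℝ) + 1) / 2 with he
  have he0 : ∀ k, 0 < e k := fun k => by simp only [he]; positivity
  have he1 : ∀ k, e k ≤ 1 / 2 := fun k => by
    simp only [he]
    gcongr
    rw [div_le_one (by positivity)]
    linarith [Nat.cast_nonneg (α := ℝ) k]
  have helim : Filter.Tendsto e Filter.atTop (nhds 0) := by
    simpa [he] using (tendsto_one_div_add_atTop_nhds_zero_nat (𝕜 := ℝ)).div_const 2
  set a := radial n u.1
  set b := radial n v.1
  have hU : ∀ k, IsSmoothRadial (mollify (e k) a) := fun k =>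
    isSmoothRadial_mollify (he0 k) hu.integrableOn (radial_comp_isometry _)
  have hV : ∀ k, IsSmoothRadial (mollify (e k) b) := fun k =>
    isSmoothRadial_mollify (he0 k) hv.integrableOn (radial_comp_isometry _)
  have hna : 0 ≤ sobolevNorm m a := sobolevNorm_nonneg
  have hnb : 0 ≤ sobolevNorm m b := sobolevNorm_nonneg
  have key := h₃ (radial n (nonlinearity d u).2 - radial n (nonlinearity d v).2)
    (fun k => approxNonlinearity d k (mollify (e k) a) - approxNonlinearity d k (mollify (e k) b))
    ((C₂ + 1) * C₁ ^ 2 * (sobolevNorm m a + sobolevNorm m b) * sobolevNorm m (a - b))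
    (fun k => (isSmoothRadial_approxNonlinearity hd k (hU k)).sub
      (isSmoothRadial_approxNonlinearity hd k (hV k)))
    (fun k => by
      have b1 := h₁ a (e k) (he0 k) (he1 k) hu
      have b2 := h₁ b (e k) (he0 k) (he1 k) hv
      have b3 := h₁ (a - b) (e k) (he0 k) (he1 k) (hu.sub hv)
      rw [mollify_sub (he0 k) hu.integrableOn hv.integrableOn] at b3
      have n1 := smoothNorm_nonneg m (mollify (e k) a)
      have n2 := smoothNorm_nonneg m (mollify (e k) b)
      have n3 := smoothNorm_nonneg m (mollify (e k) a - mollify (e k) b)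
      exact (h₂ k _ _ (hU k) (hV k) (b1.trans (mul_le_mul_of_nonneg_left huδ hC₁.le))
        (b2.trans (mul_le_mul_of_nonneg_left hvδ hC₁.le))).trans
        (mul_sum_mul_le hC₁.le hC₂ n1 n2 n3 hna hnb b1 b2 b3))
    (by
      filter_upwards [ae_tendsto_mollify hu.integrableOn he0 helim,
        ae_tendsto_mollify hv.integrableOn he0 helim, ae_ball_ne_zero] with x h1 h2 hx
      exact (tendsto_approxNonlinearity hd u hx.1 h1).sub (tendsto_approxNonlinearity hd v hx.1 h2))
    m' hm'
  exact ⟨key.1, key.2.trans_eq (by ring)⟩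

theorem radial_zero : radial n 0 = 0 := rfl

theorem radial_sub (u v : ℝ → ℂ) : radial n (u - v) = radial n u - radial n v := rfl

theorem nonlinearity_fst (d : ℕ) (u : (ℝ → ℂ) × (ℝ → ℂ)) : (nonlinearity d u).1 = 0 := rfl

theorem nonlinearity_zero_snd (d : ℕ) : (nonlinearity d 0).2 = 0 := by
  ext ρ; simp [nonlinearity, taylorRemainder]

theorem sobolevNorm_fst_le_stateNorm (d : ℕ) (u : (ℝ → ℂ) × (ℝ → ℂ)) :
    sobolevNorm ((d + 3) / 2) (radial (d + 2) u.1) ≤ stateNorm d u :=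
  Real.le_sqrt_of_sq_le (le_add_of_nonneg_right (sq_nonneg _))

theorem stateNorm_nonneg (d : ℕ) (u : (ℝ → ℂ) × (ℝ → ℂ)) : 0 ≤ stateNorm d u :=
  Real.sqrt_nonneg _

theorem stateNorm_nonlinearity_sub (d : ℕ) (u v : (ℝ → ℂ) × (ℝ → ℂ)) :
    stateNorm d (nonlinearity d u - nonlinearity d v) = sobolevNorm ((d + 1) / 2)
      (radial (d + 2) (nonlinearity d u).2 - radial (d + 2) (nonlinearity d v).2) := by
  rw [stateNorm, Prod.fst_sub, Prod.snd_sub, nonlinearity_fst, nonlinearity_fst, sub_zero,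
    radial_zero, sobolevNorm_zero, radial_sub, zero_pow two_ne_zero, zero_add,
    Real.sqrt_sq sobolevNorm_nonneg]

end WaveMaps

end

/-! ### The estimate in `𝓗` for odd d -/

open WaveMaps in
theorem mainTheorem11 (d : ℕ) (hd : 3 ≤ d) (hodd : Odd d) (δ : ℝ) (hδ : 0 < δ) :
    ∃ C : ℝ, 0 < C ∧
      ∀ u ∈ WaveMaps.stateBall d δ, ∀ v ∈ WaveMaps.stateBall d δ,
        WaveMaps.nonlinearity d u ∈ WaveMaps.stateSpace d ∧
        WaveMaps.nonlinearity d v ∈ WaveMaps.stateSpace d ∧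
        WaveMaps.stateNorm d (WaveMaps.nonlinearity d u - WaveMaps.nonlinearity d v) ≤
          C * (WaveMaps.stateNorm d u + WaveMaps.stateNorm d v) *
            WaveMaps.stateNorm d (u - v) := by
  -- Oddness makes the halving exact.
  have hm : d + 2 + 1 = 2 * ((d + 3) / 2) := by
    obtain ⟨i, hi⟩ := hodd; omega
  have hm' : (d + 1) / 2 ≤ (d + 3) / 2 := by omega
  obtain ⟨C, hC, h⟩ := exists_nonlinearity_sub_le hd (by omega) hm δ
  have hmem : ∀ u ∈ stateBall d δ, nonlinearity d u ∈ stateSpace d := by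
    intro u hu
    -- Membership is the difference estimate against zero data, where the nonlinearity vanishes.
    have h0 := (h u 0 hu.1.1 memSobolev_zero ((sobolevNorm_fst_le_stateNorm d u).trans hu.2)
      (sobolevNorm_zero.trans_le hδ.le) _ hm').1
    rw [nonlinearity_zero_snd, radial_zero, sub_zero] at h0
    exact ⟨memSobolev_zero, h0⟩
  refine ⟨C, hC, fun u hu v hv => ⟨hmem u hu, hmem v hv, ?_⟩⟩
  have h1 := sobolevNorm_fst_le_stateNorm d u
  have h2 := sobolevNorm_fst_le_stateNorm d v
  have h3 := sobolevNorm_fst_le_stateNorm d (u - v)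
  rw [Prod.fst_sub, radial_sub] at h3
  rw [stateNorm_nonlinearity_sub]
  refine (h u v hu.1.1 hv.1.1 (h1.trans hu.2) (h2.trans hv.2) _ hm').2.trans ?_
  exact mul_le_mul (mul_le_mul_of_nonneg_left (add_le_add h1 h2) hC.le) h3 sobolevNorm_nonneg
    (mul_nonneg hC.le (add_nonneg (stateNorm_nonneg d u) (stateNorm_nonneg d v)))
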